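/- **Setting.** Fix $\lambda>0$, $r>0$, $\alpha>2$, $\theta>0$, $P_{\mathrm{tx}}>0$, $\sigma^2>0$, $\xi\in(0,1]$, $p\in(0,1)$, and put $\rho=P_{\mathrm{tx}}/\sigma^2$, $\delta=2/\alpha$. Consider the Poisson bipolar network in the plane seen from its typical link, link $0$: the receiver of link $0$ is at the origin, the transmitters $X_1,X_2,\dots$ of the other links form a homogeneous Poisson point process of density $\lambda$, and every transmitter is at distance $r$ from its receiver, in an independent, uniformly random direction. Time is slotted. At the beginning of each slot a packet arrives at each transmitter with probability $\xi$ and replaces the packet stored in the unit-size buffer, if any (buffers are empty before slot $0$); a transmitter with a non-empty buffer sends its packet with probability $p$ (slotted ALOHA), and a successfully delivered packet leaves the buffer at the end of the slot. Let $\zeta_{j,t}\in\{0,1\}$ indicate that the buffer of transmitter $j$ is non-empty in slot $t$, $\nu_{j,t}\in\{0,1\}$ that it has channel access, and let $H_{j,t}\sim\exp(1)$ be the channel gain from transmitter $j$ to the origin; arrivals, channel accesses and gains are independent over nodes and slots, and of the positions. When the typical transmitter sends, $$\mathrm{SINR}_{0,t}=\frac{P_{\mathrm{tx}}H_{0,t}r^{-\alpha}}{\sum_{j\ge1}P_{\mathrm{tx}}H_{j,t}\,\zeta_{j,t}\,\nu_{j,t}\|X_j\|^{-\alpha}+\sigma^2}.$$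 **Mean-field approximation.** Each node experiences independent interferers over time, so that the queues evolve independently: given the environment $\Phi$ (the positions of all transmitters and receivers, and the conditional success probabilities $\mu_j$, $j\ge1$, of the other links), each packet sent by transmitter $j\ge1$ is delivered with probability $\mu_j$, independently over time and of everything else; and $\mu_1,\mu_2,\dots$ are i.i.d. and independent of the positions, with the same distribution as the conditional success probability $\mu_0^\Phi$ of the typical link, defined by $$\mu^\Phi_{0,t}=\mathbb P(\mathrm{SINR}_{0,t}>\theta\mid\Phi),\qquad \mu_0^\Phi=\lim_{t\to\infty}\mu_{0,t}^\Phi .$$ **Theorem.** Under the mean-field approximation the limit $\mu^\Phi_0$ exists almost surely, and its cumulative distribution function $F$ satisfies, for every $u>0$, the fixed-point equation $$F(u)=\frac12-\int_0^\infty \mathrm{Im}\left\{u^{-j\omega}\exp\left(-\frac{j\omega\theta r^\alpha}{\rho}-\lambda\pi r^2\theta^\delta\sum_{k=1}^\infty\binom{j\omega}{k}\int_0^\infty\frac{(-1)^{k+1}\,dv}{(1+v^{\alpha/2})^k}\int_0^1\frac{(p\xi)^k\,dF(t)}{[\xi+(1-\xi)pt]^k}\right)\right\}\frac{d\omega}{\pi\omega},$$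 where $j=\sqrt{-1}$ in this formula and $\mathrm{Im}$ is the imaginary part; the series and all the integrals converge (absolutely). -/

import Mathlib

open MeasureTheory ProbabilityTheory Filter Topology Set
open scoped ENNReal NNReal

noncomputable section

namespace AoINetwork

/-- The Euclidean plane. -/
abbrev Plane : Type := EuclideanSpace ℝ (Fin 2)

/-- The parameters of the network, with their admissible ranges. -/
structure NetworkParams where
  /-- spatial density of the transmitters -/
  lam : ℝ
  /-- distance between a transmitter and its receiver -/
  r : ℝ
  /-- path loss exponent -/
  alpha : ℝ
  /-- SINR decoding threshold -/
  theta : ℝ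
  /-- transmit power -/
  Ptx : ℝ
  /-- variance of the thermal noise -/
  sigmaSq : ℝ
  /-- packet arrival probability per slot -/
  xi : ℝ
  /-- channel access probability of slotted ALOHA -/
  p : ℝ
  lam_pos : 0 < lam
  r_pos : 0 < r
  two_lt_alpha : 2 < alpha
  theta_pos : 0 < theta
  Ptx_pos : 0 < Ptx
  sigmaSq_pos : 0 < sigmaSq
  xi_pos : 0 < xi
  xi_le_one : xi ≤ 1
  p_pos : 0 < p
  p_lt_one : p < 1

namespace NetworkParams

/-- The signal-to-noise ratio. -/
def rho (prm : NetworkParams) : ℝ := prm.Ptx / prm.sigmaSq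

/-- The exponent `δ = 2 / α`. -/
def delta (prm : NetworkParams) : ℝ := 2 / prm.alpha

end NetworkParams

/-! ### Poisson point processes -/

/-- The number of points of the configuration `x 0, x 1, …` that lie in `B`. -/
def pointCount (x : ℕ → Plane) (B : Set Plane) : ℕ∞ := {j : ℕ | x j ∈ B}.encard

/-- `X 0, X 1, …` enumerates the points of a homogeneous Poisson point process of intensity `lam`:
the number of points in a Borel set of finite area `|B|` is Poisson with mean `lam * |B|`, and the
numbers of points in pairwise disjoint such sets are independent. -/
structure IsPoissonProcess {Ω : Type*} [MeasurableSpace Ω] (X : ℕ → Ω → Plane) (lam : ℝ)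
    (P : Measure Ω) : Prop where
  measurable : ∀ j, Measurable (X j)
  hasLaw_count : ∀ B : Set Plane, MeasurableSet B → volume B ≠ ∞ →
    HasLaw (fun ω => pointCount (fun j => X j ω) B)
      ((poissonMeasure (ENNReal.ofReal lam * volume B).toNNReal).map (Nat.cast : ℕ → ℕ∞)) P
  indep_count : ∀ (n : ℕ) (B : Fin n → Set Plane), (∀ i, MeasurableSet (B i)) →
    (∀ i, volume (B i) ≠ ∞) → Pairwise (fun i i' => Disjoint (B i) (B i')) →
    iIndepFun (fun i ω => pointCount (fun j => X j ω) (B i)) P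

/-! ### Random inputs and buffer dynamics -/

/-- The law on `{true, false}` that gives `true` probability `q` (for `0 ≤ q ≤ 1`). -/
def coinLaw (q : ℝ) : Measure Bool :=
  ENNReal.ofReal q • Measure.dirac true + ENNReal.ofReal (1 - q) • Measure.dirac false

/-- The joint law of the inputs of one node in one time slot: packet arrival with probability `ξ`,
channel access with probability `p`, a uniform variable on `[0, 1]` that is used to decide success,
and a unit-mean exponential power gain (Rayleigh fading); the four are independent. -/
def slotLaw (prm : NetworkParams) : Measure (Bool × Bool × ℝ × ℝ) :=
  (coinLaw prm.xi).prod ((coinLaw prm.p).prod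
    ((volume[|Icc (0 : ℝ) 1]).prod (expMeasure 1)))

/-- Evolution of a unit buffer under last-come first-serve with replacement: `buffer A S t` is
`true` when the buffer is non-empty in slot `t`, right after the possible arrival at the beginning
of that slot. `A t` says that a packet arrives in slot `t` (it replaces the stored one, if any), and
`S t` that in slot `t` a stored packet is sent, delivered, and removed at the end of the slot.
Before slot `0` the buffer is empty. -/
def buffer (A S : ℕ → Bool) : ℕ → Bool
  | 0 => A 0
  | t + 1 => A (t + 1) || (buffer A S t && !S t)

/-- The unit vector in direction `a`. -/
def direction (a : ℝ) : Plane := !₂[Real.cos a, Real.sin a]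

/-- The Poisson bipolar network seen from its typical link, under the mean-field approximation.
Node `0` is the typical link, whose receiver is at the origin; the transmitters of the nodes
`1, 2, …` form a Poisson point process.

Mean-field approximation: node `j + 1` sees independent interferers over time, so that, given the
environment, each packet it sends is delivered with probability `rate j`, independently over time
and of all other nodes; and the success probabilities `rate j` of the links are i.i.d. with law
`law`, independently of the positions. -/
structure MeanFieldNetwork (prm : NetworkParams) (law : Measure ℝ)
    {Ω : Type*} [MeasurableSpace Ω] (P : Measure Ω) where
  /-- position of the transmitter of node `j + 1` -/
  interferer : ℕ → Ω → Plane
  /-- orientation of link `j` -/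
  angle : ℕ → Ω → ℝ
  /-- conditional transmission success probability of link `j + 1` -/
  rate : ℕ → Ω → ℝ
  /-- packet arrival at node `j` in slot `t` -/
  arrival : ℕ → ℕ → Ω → Bool
  /-- ALOHA channel access of node `j` in slot `t` -/
  access : ℕ → ℕ → Ω → Bool
  /-- uniform variable that decides the success of a transmission of node `j` in slot `t` -/
  unif : ℕ → ℕ → Ω → ℝ
  /-- power gain of the channel from transmitter `j` to the typical receiver in slot `t` -/
  fading : ℕ → ℕ → Ω → ℝ
  poisson : IsPoissonProcess interferer prm.lam P
  measurable_angle : ∀ j, Measurable (angle j)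
  measurable_rate : ∀ j, Measurable (rate j)
  measurable_arrival : ∀ j t, Measurable (arrival j t)
  measurable_access : ∀ j t, Measurable (access j t)
  measurable_unif : ∀ j t, Measurable (unif j t)
  measurable_fading : ∀ j t, Measurable (fading j t)
  /-- Positions, orientations, success probabilities and slot inputs are independent of each other;
  the orientations are i.i.d. uniform, the success probabilities are i.i.d. with law `law`, and the
  slot inputs are i.i.d. over nodes and slots. -/
  joint_law : HasLaw
    (fun ω => ((fun j => interferer j ω), (fun j => angle j ω), (fun j => rate j ω),
      (fun jt : ℕ × ℕ => (arrival jt.1 jt.2 ω, access jt.1 jt.2 ω, unif jt.1 jt.2 ω,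
        fading jt.1 jt.2 ω))))
    ((P.map (fun ω j => interferer j ω)).prod
      ((Measure.infinitePi (fun _ : ℕ => volume[|Ioc (0 : ℝ) (2 * Real.pi)])).prod
        ((Measure.infinitePi (fun _ : ℕ => law)).prod
          (Measure.infinitePi (fun _ : ℕ × ℕ => slotLaw prm))))) P

namespace MeanFieldNetwork

variable {prm : NetworkParams} {law : Measure ℝ} {Ω : Type*} [MeasurableSpace Ω] {P : Measure Ω}

/-- The position of the transmitter of node `j`. -/
def tx (net : MeanFieldNetwork prm law P) : ℕ → Ω → Plane
  | 0, ω => -(prm.r • direction (net.angle 0 ω))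
  | j + 1, ω => net.interferer j ω

/-- The position of the receiver of node `j`. -/
def rx (net : MeanFieldNetwork prm law P) (j : ℕ) (ω : Ω) : Plane :=
  net.tx j ω + prm.r • direction (net.angle j ω)

/-- The indicator that the buffer of node `j + 1` is non-empty in slot `t`. -/
def nonempty (net : MeanFieldNetwork prm law P) (j t : ℕ) (ω : Ω) : Bool :=
  buffer (fun s => net.arrival (j + 1) s ω)
    (fun s => net.access (j + 1) s ω && decide (net.unif (j + 1) s ω < net.rate j ω)) t

/-- The total interference power at the typical receiver in slot `t`. -/
def interference (net : MeanFieldNetwork prm law P) (t : ℕ) (ω : Ω) : ℝ≥0∞ :=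
  ∑' j : ℕ, if net.nonempty j t ω && net.access (j + 1) t ω then
    ENNReal.ofReal (prm.Ptx * net.fading (j + 1) t ω *
      ‖net.tx (j + 1) ω - net.rx 0 ω‖ ^ (-prm.alpha)) else 0

/-- The SINR at the typical receiver in slot `t`, when the typical transmitter is sending. -/
def sinr (net : MeanFieldNetwork prm law P) (t : ℕ) (ω : Ω) : ℝ≥0∞ :=
  ENNReal.ofReal (prm.Ptx * net.fading 0 t ω * ‖net.tx 0 ω - net.rx 0 ω‖ ^ (-prm.alpha)) /
    (net.interference t ω + ENNReal.ofReal prm.sigmaSq)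

/-- The σ-algebra of the environment: all positions of transmitters and receivers, and the
conditional success probabilities of the links of the interferers. -/
abbrev environment (net : MeanFieldNetwork prm law P) : MeasurableSpace Ω :=
  MeasurableSpace.comap
    (fun ω => ((fun j => net.tx j ω), (fun j => net.rx j ω), (fun j => net.rate j ω)))
    (inferInstance : MeasurableSpace ((ℕ → Plane) × (ℕ → Plane) × (ℕ → ℝ)))

/-- The conditional transmission success probability of the typical link in slot `t`: the
conditional probability, given the environment, that the SINR exceeds `θ`. -/
def slotSuccessProb (net : MeanFieldNetwork prm law P) (t : ℕ) : Ω → ℝ :=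
  P⟦{ω | ENNReal.ofReal prm.theta < net.sinr t ω} | net.environment⟧

/-- The conditional transmission success probability of the typical link: the limit over time. -/
def successProb (net : MeanFieldNetwork prm law P) (ω : Ω) : ℝ :=
  limUnder atTop (fun t => net.slotSuccessProb t ω)

/-- All links are statistically equivalent: the typical link's conditional success probability has
the same law as those of its interferers. -/
def IsSelfConsistent (net : MeanFieldNetwork prm law P) : Prop :=
  HasLaw net.successProb law P

end MeanFieldNetwork

/-! ### The fixed-point equation -/

/-- The integrand of `∫₀^∞ (-1)^(k+1) / (1 + v^(α/2))^k dv`. -/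
def pathLossIntegrand (prm : NetworkParams) (k : ℕ) (v : ℝ) : ℝ :=
  (-1) ^ (k + 1) / (1 + v ^ (prm.alpha / 2)) ^ k

/-- The `k`-th term of the binomial series in `jω`, with `∫₀¹ … dF(t)` a Stieltjes integral. -/
def seriesTerm (prm : NetworkParams) (F : StieltjesFunction ℝ) (w : ℝ) (k : ℕ) : ℂ :=
  Ring.choose (Complex.I * w) k *
    ((∫ v in Ioi (0 : ℝ), pathLossIntegrand prm k v : ℝ) : ℂ) *
    ((∫ t in Icc (0 : ℝ) 1,
      (prm.p * prm.xi) ^ k / (prm.xi + (1 - prm.xi) * prm.p * t) ^ k ∂F.measure : ℝ) : ℂ)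

/-- The integrand in `ω` of the fixed-point equation at the point `u`. -/
def inversionIntegrand (prm : NetworkParams) (F : StieltjesFunction ℝ) (u w : ℝ) : ℝ :=
  ((u : ℂ) ^ (-(Complex.I * w)) *
    Complex.exp (-(Complex.I * w * ((prm.theta * prm.r ^ prm.alpha / prm.rho : ℝ) : ℂ))
      - ((prm.lam * Real.pi * prm.r ^ 2 * prm.theta ^ prm.delta : ℝ) : ℂ)
        * ∑' k : ℕ, seriesTerm prm F w (k + 1))).im / (Real.pi * w)

end AoINetwork

end

/-!
Fading is exponential, so given the environment and the activity of the interferers the success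
probability is the Laplace transform of noise plus interference. Conditionally on the environment
the interferers are independent, hence the success probability in slot `t` is `exp (-θ r^α / ρ)`
times the product over the interferers `x` of `1 - p b_t(m) d(x)`. Here `m` is the rate of the
interferer, `b_t(m)` the probability that its buffer is non-empty, and
`d(x) = θ r^α ‖x‖^(-α) / (1 + θ r^α ‖x‖^(-α))` (`blockProb`), the probability that an active
interferer at `x` alone destroys the packet. The buffer is a two-state chain whose occupation
probability converges geometrically to `ξ / (ξ + (1 - ξ) p m)`. Since `α > 2`, `d` is integrable over
the plane, so by Campbell's formula `∑ d(x)` is almost surely finite. Dominated convergence then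
gives the limit over time: with `a(m) = p ξ / (ξ + (1 - ξ) p m)` (`activity`), the logarithm of the
success probability is `-θ r^α / ρ + ∑ log (1 - a(m) d(x))` (`successProb_ae_eq`).

The sum runs over a Poisson process with independent marks, so the characteristic function of this
logarithm is given by the generating functional: its exponent is
`-jωθ r^α / ρ - λ ∫ E[1 - (1 - a d(x))^(jω)] dx` (`charFun_map_logProb`). A radial change of variables
turns `dx` into `π r² θ^δ dv` and `d` into `1 / (1 + v^(α/2))`, and expanding `(1 - a d)^(jω)` in its
binomial series, which converges uniformly because `0 ≤ a d ≤ p < 1`, produces the series of the theorem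
(`hasSum_radialExponent`).

The integral over `ω` is the Gil-Pelaez inversion formula for the logarithm. Near zero its
integrand is bounded, since the logarithm has a first moment. At infinity the modulus of the
characteristic function is at most `exp (-c ω^δ)`: interferers at distances of order `ω^(1/α)`
contribute phases that are bounded away from `0` and at most `π`, and the expected number of such
interferers is of order `ω^δ` (`exists_le_re_radialExponent`). Integrability of the characteristic
function excludes atoms and gives the inversion formula at every point
(`integrableOn_and_measureReal_Iic_eq_of_charFun`). Finally, self-consistency says that the law of the
rates is the law of the success probability itself.
-/

/-! ### Inversion of an integrable characteristic function -/

lemma integrableOn_exp_neg_mul_Ioi_zero {ε : ℝ} (hε : 0 < ε) :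
    IntegrableOn (fun w : ℝ => Real.exp (-(ε * w))) (Ioi 0) := by
  simpa [neg_mul] using integrableOn_exp_mul_Ioi (a := -ε) (by linarith) 0

lemma integral_exp_neg_mul_mul_cos {ε : ℝ} (hε : 0 < ε) (y : ℝ) :
    ∫ w in Ioi (0 : ℝ), Real.exp (-(ε * w)) * Real.cos (w * y) = ε / (ε ^ 2 + y ^ 2) := by
  have ha : ((-ε : ℝ) + (y : ℝ) * Complex.I : ℂ).re < 0 := by simpa using hε
  have h1 := integral_exp_mul_complex_Ioi ha 0
  have h2 := integrableOn_exp_mul_complex_Ioi ha 0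
  have h3 := integral_re (𝕜 := ℂ) h2
  rw [h1] at h3
  have h4 : ∀ w : ℝ, RCLike.re (Complex.exp (((-ε : ℝ) + (y : ℝ) * Complex.I : ℂ) * w))
      = Real.exp (-(ε * w)) * Real.cos (w * y) := by
    intro w
    have : ((-ε : ℝ) + (y : ℝ) * Complex.I : ℂ) * w
        = ((-(ε * w) : ℝ) : ℂ) + ((w * y : ℝ) : ℂ) * Complex.I := by push_cast; ring
    rw [this, RCLike.re_eq_complex_re, Complex.exp_re]
    simp
  simp_rw [h4] at h3
  rw [h3]
  simp [Complex.div_re, Complex.normSq_apply]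
  ring

/-- The Dirichlet integral with an Abel factor: both sides vanish at `y = 0` and have the same
derivative in `y`. -/
lemma integral_exp_neg_mul_mul_sin_div {ε : ℝ} (hε : 0 < ε) (y : ℝ) :
    ∫ w in Ioi (0 : ℝ), Real.exp (-(ε * w)) * (Real.sin (w * y) / w) = Real.arctan (y / ε) := by
  set F : ℝ → ℝ := fun y => ∫ w in Ioi (0 : ℝ), Real.exp (-(ε * w)) * (Real.sin (w * y) / w)
  have hmeas : ∀ y : ℝ, AEStronglyMeasurable
      (fun w : ℝ => Real.exp (-(ε * w)) * (Real.sin (w * y) / w)) (volume.restrict (Ioi 0)) :=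
    fun y => (by fun_prop : Measurable _).aestronglyMeasurable
  have hderiv : ∀ y, HasDerivAt F (ε / (ε ^ 2 + y ^ 2)) y := by
    intro y
    rw [← integral_exp_neg_mul_mul_cos hε y]
    refine (hasDerivAt_integral_of_dominated_loc_of_deriv_le (μ := volume.restrict (Ioi (0 : ℝ)))
      (F := fun y w => Real.exp (-(ε * w)) * (Real.sin (w * y) / w))
      (F' := fun y w => Real.exp (-(ε * w)) * Real.cos (w * y))
      (bound := fun w => Real.exp (-(ε * w))) (s := univ) (x₀ := y) univ_mem
      (Eventually.of_forall hmeas) ?_ ?_ ?_ (integrableOn_exp_neg_mul_Ioi_zero hε) ?_).2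
    · refine ((integrableOn_exp_neg_mul_Ioi_zero hε).mul_const |y|).mono' (hmeas y) ?_
      refine (ae_restrict_mem measurableSet_Ioi).mono fun w (hw : 0 < w) => ?_
      rw [norm_mul, Real.norm_of_nonneg (Real.exp_pos _).le, norm_div, Real.norm_of_nonneg hw.le,
        Real.norm_eq_abs]
      gcongr
      rw [div_le_iff₀ hw]
      calc |Real.sin (w * y)| ≤ |w * y| := Real.abs_sin_le_abs
        _ = |y| * w := by rw [abs_mul, abs_of_pos hw, mul_comm]
    · exact (by fun_prop : Measurable _).aestronglyMeasurable
    · refine Eventually.of_forall fun w x _ => ?_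
      rw [norm_mul, Real.norm_of_nonneg (Real.exp_pos _).le]
      exact mul_le_of_le_one_right (Real.exp_pos _).le (Real.abs_cos_le_one _)
    · refine (ae_restrict_mem measurableSet_Ioi).mono fun w (hw : 0 < w) x _ => ?_
      have h1 : HasDerivAt (fun x : ℝ => Real.sin (w * x)) (Real.cos (w * x) * w) x := by
        simpa using ((hasDerivAt_id x).const_mul w).sin
      have h2 := (h1.div_const w).const_mul (Real.exp (-(ε * w)))
      convert! h2 using 1
      field_simp
  have harctan : ∀ y, HasDerivAt (fun y => Real.arctan (y / ε)) (ε / (ε ^ 2 + y ^ 2)) y := by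
    intro y
    convert! ((hasDerivAt_id y).div_const ε).arctan using 1
    simp only [id]
    field_simp
  have hconst := is_const_of_deriv_eq_zero (f := fun y => F y - Real.arctan (y / ε))
    (fun y => ((hderiv y).sub (harctan y)).differentiableAt)
    (fun y => by
      have h := ((hderiv y).sub (harctan y)).deriv
      rw [sub_self] at h
      exact h) y 0
  have h0 : F 0 = 0 := by simp [F]
  simp only [h0, zero_div, Real.arctan_zero, sub_self] at hconst
  linarith

section CenteredInversion

variable {μ : Measure ℝ} [IsProbabilityMeasure μ]

lemma re_charFun_eq_integral_cos (w : ℝ) :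
    (charFun μ w).re = ∫ y, Real.cos (w * y) ∂μ := by
  have hint : Integrable (fun y : ℝ => Complex.exp (w * y * Complex.I)) μ :=
    Integrable.of_bound (C := 1) (by fun_prop) (ae_of_all _ fun y => by
      rw [show (w * y * Complex.I : ℂ) = ((w * y : ℝ) : ℂ) * Complex.I by push_cast; ring,
        Complex.norm_exp_ofReal_mul_I])
  have := integral_re (𝕜 := ℂ) hint
  rw [charFun_apply_real]
  refine Eq.trans this.symm (integral_congr_ae (ae_of_all _ fun y => ?_))
  simp only [RCLike.re_eq_complex_re]
  rw [show (w * y * Complex.I : ℂ) = ((w * y : ℝ) : ℂ) * Complex.I by push_cast; ring,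
    Complex.exp_ofReal_mul_I_re]

lemma im_charFun_eq_integral_sin (w : ℝ) :
    (charFun μ w).im = ∫ y, Real.sin (w * y) ∂μ := by
  have hint : Integrable (fun y : ℝ => Complex.exp (w * y * Complex.I)) μ :=
    Integrable.of_bound (C := 1) (by fun_prop) (ae_of_all _ fun y => by
      rw [show (w * y * Complex.I : ℂ) = ((w * y : ℝ) : ℂ) * Complex.I by push_cast; ring,
        Complex.norm_exp_ofReal_mul_I])
  have := integral_im (𝕜 := ℂ) hint
  rw [charFun_apply_real]
  refine Eq.trans this.symm (integral_congr_ae (ae_of_all _ fun y => ?_))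
  simp only [RCLike.im_eq_complex_im]
  rw [show (w * y * Complex.I : ℂ) = ((w * y : ℝ) : ℂ) * Complex.I by push_cast; ring,
    Complex.exp_ofReal_mul_I_im]

lemma abs_im_charFun_div_le (hμ : Integrable (fun y : ℝ => y) μ) {w : ℝ} (hw : 0 < w) :
    |(charFun μ w).im / w| ≤ ∫ y, |y| ∂μ := by
  rw [abs_div, abs_of_pos hw, div_le_iff₀ hw, im_charFun_eq_integral_sin]
  calc |∫ y, Real.sin (w * y) ∂μ| ≤ ∫ y, |Real.sin (w * y)| ∂μ := abs_integral_le_integral_abs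
    _ ≤ ∫ y, |y| * w ∂μ := by
        refine integral_mono_of_nonneg (ae_of_all _ fun y => abs_nonneg _) (hμ.abs.mul_const w)
          (ae_of_all _ fun y => ?_)
        calc |Real.sin (w * y)| ≤ |w * y| := Real.abs_sin_le_abs
          _ = |y| * w := by rw [abs_mul, abs_of_pos hw, mul_comm]
    _ = (∫ y, |y| ∂μ) * w := integral_mul_const _ _

/-- A first moment controls the singularity of `Im φ(w) / w` at `0`, and integrability of `φ`
controls it at infinity. -/
lemma integrableOn_im_charFun_div (hμ : Integrable (fun y : ℝ => y) μ)
    (hφ : IntegrableOn (charFun μ) (Ioi 0)) :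
    IntegrableOn (fun w => (charFun μ w).im / w) (Ioi 0) := by
  have hm : Measurable (fun w => (charFun μ w).im / w) :=
    (Complex.measurable_im.comp measurable_charFun).div measurable_id
  rw [← Ioc_union_Ioi_eq_Ioi (zero_le_one' ℝ)]
  refine IntegrableOn.union ?_ ?_
  · refine Measure.integrableOn_of_bounded (M := ∫ y, |y| ∂μ) (by simp) hm.aestronglyMeasurable ?_
    exact (ae_restrict_mem measurableSet_Ioc).mono fun w hw => abs_im_charFun_div_le hμ hw.1
  · refine Integrable.mono (hφ.mono_set (Ioi_subset_Ioi zero_le_one)) hm.aestronglyMeasurable ?_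
    refine (ae_restrict_mem measurableSet_Ioi).mono fun w (hw : 1 < w) => ?_
    rw [norm_div]
    exact (div_le_self (norm_nonneg _)
      (by rw [Real.norm_of_nonneg (by linarith)]; exact hw.le)).trans (Complex.abs_im_le_norm _)

lemma integral_exp_neg_mul_mul_re_charFun {ε : ℝ} (hε : 0 < ε) :
    ∫ w in Ioi (0 : ℝ), Real.exp (-(ε * w)) * (charFun μ w).re
      = ∫ y, ε / (ε ^ 2 + y ^ 2) ∂μ := by
  simp_rw [re_charFun_eq_integral_cos, ← integral_const_mul]
  rw [integral_integral_swap]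
  · simp_rw [integral_exp_neg_mul_mul_cos hε]
  · have := (integrableOn_exp_neg_mul_Ioi_zero hε).mul_prod (integrable_const (μ := μ) (1 : ℝ))
    refine this.mono' (by fun_prop) (ae_of_all _ fun z => ?_)
    simp only [Function.uncurry, norm_mul, Real.norm_of_nonneg (Real.exp_pos _).le, mul_one]
    exact mul_le_of_le_one_right (Real.exp_pos _).le (Real.abs_cos_le_one _)

lemma integral_exp_neg_mul_mul_im_charFun_div (hμ : Integrable (fun y : ℝ => y) μ)
    {ε : ℝ} (hε : 0 < ε) :
    ∫ w in Ioi (0 : ℝ), Real.exp (-(ε * w)) * ((charFun μ w).im / w)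
      = ∫ y, Real.arctan (y / ε) ∂μ := by
  simp_rw [im_charFun_eq_integral_sin, ← integral_div, ← integral_const_mul]
  rw [integral_integral_swap]
  · simp_rw [integral_exp_neg_mul_mul_sin_div hε]
  · have := (integrableOn_exp_neg_mul_Ioi_zero hε).mul_prod hμ.abs
    refine this.mono' (by fun_prop) ?_
    have h : ∀ᵐ z ∂((volume.restrict (Ioi (0 : ℝ))).prod μ), z.1 ∈ Ioi (0 : ℝ) :=
      Measure.quasiMeasurePreserving_fst.ae (ae_restrict_mem measurableSet_Ioi)
    refine h.mono fun z (hz : 0 < z.1) => ?_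
    simp only [Function.uncurry, norm_mul, Real.norm_of_nonneg (Real.exp_pos _).le, norm_div,
      Real.norm_of_nonneg hz.le, Real.norm_eq_abs]
    gcongr
    rw [div_le_iff₀ hz]
    calc |Real.sin (z.1 * z.2)| ≤ |z.1 * z.2| := Real.abs_sin_le_abs
      _ = |z.2| * z.1 := by rw [abs_mul, abs_of_pos hz, mul_comm]

/-- A law with integrable characteristic function has no atom at `0`: the Poisson-kernel average
`E[ε² / (ε² + Y²)]` tends to `P(Y = 0)`, and it is `ε` times a bounded integral. -/
lemma measureReal_singleton_zero_of_integrableOn_charFun (hφ : IntegrableOn (charFun μ) (Ioi 0)) :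
    μ.real {0} = 0 := by
  set e : ℕ → ℝ := fun n => 1 / ((n : ℝ) + 1)
  have he : ∀ n, 0 < e n := fun n => by positivity
  have he0 : Tendsto e atTop (𝓝 0) := tendsto_one_div_add_atTop_nhds_zero_nat
  have h1 : Tendsto (fun n => ∫ y, e n * (e n / (e n ^ 2 + y ^ 2)) ∂μ) atTop
      (𝓝 (∫ y, ({0} : Set ℝ).indicator 1 y ∂μ)) := by
    refine tendsto_integral_of_dominated_convergence (fun _ => 1)
      (fun n => (by fun_prop : Measurable _).aestronglyMeasurable) (integrable_const _)
      (fun n => ae_of_all _ fun y => ?_) (ae_of_all _ fun y => ?_)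
    · have := he n
      rw [Real.norm_of_nonneg (by positivity), ← mul_div_assoc, div_le_one (by positivity)]
      nlinarith [sq_nonneg y]
    · by_cases hy : y = 0
      · subst hy
        simp only [mem_singleton_iff, indicator_of_mem, Pi.one_apply]
        refine tendsto_const_nhds.congr fun n => ?_
        have := (he n).ne'
        field_simp
        simp
      · simp only [mem_singleton_iff, hy, not_false_eq_true, indicator_of_notMem]
        have : Tendsto (fun n => e n * (e n / (e n ^ 2 + y ^ 2))) atTop
            (𝓝 (0 * (0 / (0 ^ 2 + y ^ 2)))) :=
          he0.mul (he0.div ((he0.pow 2).add_const _) (by positivity))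
        simpa using this
  rw [integral_indicator_one (measurableSet_singleton 0)] at h1
  have h2 : Tendsto (fun n => e n * ∫ w in Ioi (0 : ℝ), ‖charFun μ w‖) atTop (𝓝 0) := by
    simpa using he0.mul_const (∫ w in Ioi (0 : ℝ), ‖charFun μ w‖)
  refine le_antisymm (le_of_tendsto_of_tendsto' h1 h2 fun n => ?_) measureReal_nonneg
  rw [integral_const_mul, ← integral_exp_neg_mul_mul_re_charFun (he n)]
  refine mul_le_mul_of_nonneg_left ?_ (he n).le
  refine (le_abs_self _).trans ((abs_integral_le_integral_abs).trans ?_)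
  refine integral_mono_of_nonneg (ae_of_all _ fun w => abs_nonneg _) hφ.norm ?_
  refine (ae_restrict_mem measurableSet_Ioi).mono fun w (hw : 0 < w) => ?_
  simp only [abs_mul, abs_of_pos (Real.exp_pos _)]
  refine (mul_le_of_le_one_left (abs_nonneg _) ?_).trans (Complex.abs_re_le_norm _)
  rw [Real.exp_le_one_iff]
  have := mul_pos (he n) hw
  linarith

lemma tendsto_arctan_div_nhds_sign {e : ℕ → ℝ} (he : ∀ n, 0 < e n) (he0 : Tendsto e atTop (𝓝 0))
    (y : ℝ) : Tendsto (fun n => Real.arctan (y / e n)) atTop (𝓝 (Real.pi / 2 * Real.sign y)) := by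
  have hinv : Tendsto (fun n => (e n)⁻¹) atTop atTop :=
    tendsto_inv_nhdsGT_zero.comp (tendsto_nhdsWithin_iff.2 ⟨he0, Eventually.of_forall he⟩)
  rcases lt_trichotomy y 0 with hy | rfl | hy
  · rw [Real.sign_of_neg hy, mul_neg_one]
    exact (tendsto_nhds_of_tendsto_nhdsWithin Real.tendsto_arctan_atBot).comp
      (hinv.const_mul_atTop_of_neg hy)
  · simp
  · rw [Real.sign_of_pos hy, mul_one]
    exact (tendsto_nhds_of_tendsto_nhdsWithin Real.tendsto_arctan_atTop).comp
      (hinv.const_mul_atTop hy)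

/-- Abel summation of `∫ Im φ(w) / w dw`: with the factor `exp (-ε w)` the integral equals
`E[arctan (Y / ε)]`, which tends to `π / 2 · E[sign Y]`. -/
lemma integral_im_charFun_div (hμ : Integrable (fun y : ℝ => y) μ)
    (hφ : IntegrableOn (charFun μ) (Ioi 0)) :
    ∫ w in Ioi (0 : ℝ), (charFun μ w).im / w = ∫ y, Real.pi / 2 * Real.sign y ∂μ := by
  set e : ℕ → ℝ := fun n => 1 / ((n : ℝ) + 1)
  have he : ∀ n, 0 < e n := fun n => by positivity
  have he0 : Tendsto e atTop (𝓝 0) := tendsto_one_div_add_atTop_nhds_zero_nat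
  have hm : Measurable (fun w => (charFun μ w).im / w) :=
    (Complex.measurable_im.comp measurable_charFun).div measurable_id
  have h1 : Tendsto (fun n => ∫ w in Ioi (0 : ℝ), Real.exp (-(e n * w)) * ((charFun μ w).im / w))
      atTop (𝓝 (∫ w in Ioi (0 : ℝ), (charFun μ w).im / w)) := by
    refine tendsto_integral_of_dominated_convergence (fun w => ‖(charFun μ w).im / w‖)
      (fun n => ?_) (integrableOn_im_charFun_div hμ hφ).norm (fun n => ?_)
      (ae_of_all _ fun w => ?_)
    · exact ((by fun_prop : Measurable fun w : ℝ => Real.exp (-(e n * w))).mul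
        hm).aestronglyMeasurable
    · refine (ae_restrict_mem measurableSet_Ioi).mono fun w (hw : 0 < w) => ?_
      rw [norm_mul, Real.norm_of_nonneg (Real.exp_pos _).le]
      refine mul_le_of_le_one_left (norm_nonneg _) ?_
      rw [Real.exp_le_one_iff]
      have := mul_pos (he n) hw
      linarith
    · have : Tendsto (fun n => Real.exp (-(e n * w)) * ((charFun μ w).im / w)) atTop
          (𝓝 (Real.exp (-(0 * w)) * ((charFun μ w).im / w))) :=
        ((Real.continuous_exp.tendsto _).comp (he0.mul_const w).neg).mul_const _
      simpa using this
  have h2 : Tendsto (fun n => ∫ y, Real.arctan (y / e n) ∂μ) atTop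
      (𝓝 (∫ y, Real.pi / 2 * Real.sign y ∂μ)) := by
    refine tendsto_integral_of_dominated_convergence (fun _ => Real.pi / 2)
      (fun n => (Real.measurable_arctan.comp (measurable_id.div_const _)).aestronglyMeasurable)
      (integrable_const _) (fun n => ae_of_all _ fun y => ?_)
      (ae_of_all _ fun y => tendsto_arctan_div_nhds_sign he he0 y)
    exact abs_le.2 ⟨(Real.neg_pi_div_two_lt_arctan _).le, (Real.arctan_lt_pi_div_two _).le⟩
  refine tendsto_nhds_unique h1 (h2.congr fun n => ?_)
  rw [integral_exp_neg_mul_mul_im_charFun_div hμ (he n)]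

lemma measureReal_Iic_zero_eq_of_integrableOn_charFun (hμ : Integrable (fun y : ℝ => y) μ)
    (hφ : IntegrableOn (charFun μ) (Ioi 0)) :
    μ.real (Iic 0) = 1 / 2 - ∫ w in Ioi (0 : ℝ), (charFun μ w).im / (Real.pi * w) := by
  have h0 := measureReal_singleton_zero_of_integrableOn_charFun hφ
  have hsign : ∀ᵐ y ∂μ, Real.pi / 2 * Real.sign y
      = Real.pi / 2 - Real.pi * (Iic (0 : ℝ)).indicator 1 y := by
    have : ∀ᵐ y ∂μ, y ≠ 0 := by
      rw [ae_iff]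
      simpa [measureReal_eq_zero_iff] using h0
    refine this.mono fun y hy => ?_
    rcases lt_or_gt_of_ne hy with h | h
    · rw [Real.sign_of_neg h, indicator_of_mem (mem_Iic.2 h.le)]; simp; ring
    · rw [Real.sign_of_pos h, indicator_of_notMem (by simpa using h)]; simp
  have h1 := integral_im_charFun_div hμ hφ
  rw [integral_congr_ae hsign, integral_sub (integrable_const _)
    (((integrable_const (1 : ℝ)).indicator (f := (1 : ℝ → ℝ)) measurableSet_Iic).const_mul _),
    integral_const_mul,
    integral_indicator_one measurableSet_Iic] at h1
  have h2 : ∀ w : ℝ, (charFun μ w).im / (Real.pi * w) = Real.pi⁻¹ * ((charFun μ w).im / w) := by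
    intro w; rw [mul_comm Real.pi, ← div_div]; ring
  simp_rw [h2]
  rw [integral_const_mul, h1]
  simp only [integral_const, probReal_univ, one_smul]
  have := Real.pi_pos.ne'
  field_simp
  ring

end CenteredInversion

lemma charFun_map_sub_const (μ : Measure ℝ) [IsProbabilityMeasure μ] (s w : ℝ) :
    charFun (μ.map (fun y => y - s)) w = Complex.exp (-(w * s * Complex.I)) * charFun μ w := by
  have := charFun_map_add_const (μ := μ) (-s) w
  simp only [← sub_eq_add_neg] at this
  rw [this, mul_comm]
  congr 2
  simp

/-- **Gil-Pelaez inversion formula** for a law with a first moment and an integrable characteristic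
function; both integrability properties make the integral absolutely convergent, and the second
one excludes atoms. -/
theorem integrableOn_and_measureReal_Iic_eq_of_charFun {μ : Measure ℝ} [IsProbabilityMeasure μ]
    (hμ : Integrable (fun y : ℝ => y) μ) (hφ : IntegrableOn (charFun μ) (Ioi 0)) (s : ℝ) :
    IntegrableOn (fun w : ℝ =>
      (Complex.exp (-(w * s * Complex.I)) * charFun μ w).im / (Real.pi * w)) (Ioi 0) ∧
    μ.real (Iic s) = 1 / 2 - ∫ w in Ioi (0 : ℝ),
      (Complex.exp (-(w * s * Complex.I)) * charFun μ w).im / (Real.pi * w) := by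
  have hms : Measurable (fun y : ℝ => y - s) := by fun_prop
  have : IsProbabilityMeasure (μ.map (fun y => y - s)) :=
    Measure.isProbabilityMeasure_map hms.aemeasurable
  have h1 : Integrable (fun y : ℝ => y) (μ.map (fun y => y - s)) := by
    rw [integrable_map_measure (by fun_prop) hms.aemeasurable]
    exact hμ.sub (integrable_const s)
  have h2 : IntegrableOn (charFun (μ.map (fun y => y - s))) (Ioi 0) := by
    refine Integrable.mono hφ measurable_charFun.aestronglyMeasurable (ae_of_all _ fun w => ?_)
    rw [charFun_map_sub_const, norm_mul,
      show (-(w * s * Complex.I) : ℂ) = ((-(w * s) : ℝ) : ℂ) * Complex.I by push_cast; ring,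
      Complex.norm_exp_ofReal_mul_I, one_mul]
  have h3 := integrableOn_im_charFun_div h1 h2
  have h4 := measureReal_Iic_zero_eq_of_integrableOn_charFun h1 h2
  simp_rw [charFun_map_sub_const] at h3 h4
  refine ⟨?_, ?_⟩
  · refine (h3.const_mul Real.pi⁻¹).congr (ae_of_all _ fun w => ?_)
    simp only
    rw [mul_comm Real.pi w, ← div_div]; ring
  · rw [← h4, map_measureReal_apply hms measurableSet_Iic]
    congr 1
    ext y
    simp

/-! ### Poisson point processes: Campbell's formula and the generating functional -/

lemma lintegral_natCast_poissonMeasure (r : ℝ≥0) :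
    ∫⁻ n, (n : ℝ≥0∞) ∂(poissonMeasure r) = r := by
  have hr : (0 : ℝ) ≤ r := r.2
  have hterm : ∀ n : ℕ, Real.exp (-r) * r ^ (n + 1) / (n + 1).factorial * ((n + 1 : ℕ) : ℝ)
      = (Real.exp (-r) * r ^ n / n.factorial) * r := by
    intro n
    rw [Nat.factorial_succ]
    push_cast
    have : (n.factorial : ℝ) ≠ 0 := by positivity
    field_simp
    ring
  have hs : HasSum (fun n : ℕ => Real.exp (-r) * r ^ (n + 1) / (n + 1).factorial
      * ((n + 1 : ℕ) : ℝ)) r := by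
    simp_rw [hterm]
    simpa using (hasSum_one_poissonMeasure r).mul_right (r : ℝ)
  have hs' : HasSum (fun n : ℕ => Real.exp (-r) * r ^ n / n.factorial * (n : ℝ)) r := by
    rw [← hasSum_nat_add_iff' 1]
    simpa using hs
  rw [poissonMeasure, lintegral_sum_measure]
  simp_rw [lintegral_smul_measure, lintegral_dirac, smul_eq_mul]
  have hcast : ∀ n : ℕ, ENNReal.ofReal (Real.exp (-r) * r ^ n / n.factorial) * (n : ℝ≥0∞)
      = ENNReal.ofReal (Real.exp (-r) * r ^ n / n.factorial * (n : ℝ)) := by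
    intro n
    rw [ENNReal.ofReal_mul (by positivity), ENNReal.ofReal_natCast]
  simp_rw [hcast]
  rw [← ENNReal.ofReal_tsum_of_nonneg (fun n => by positivity) hs'.summable, hs'.tsum_eq]
  simp

lemma integral_pow_poissonMeasure (r : ℝ≥0) (z : ℂ) :
    ∫ n, z ^ n ∂(poissonMeasure r) = Complex.exp (r * (z - 1)) := by
  rw [integral_poissonMeasure]
  calc ∑' n : ℕ, (Real.exp (-r) * r ^ n / n.factorial) • z ^ n
      = ∑' n : ℕ, (Real.exp (-r) : ℂ) * ((r * z) ^ n / n.factorial) := by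
        congr with n
        rw [Complex.real_smul]
        push_cast
        ring
    _ = (Real.exp (-r) : ℂ) * Complex.exp (r * z) := by
        rw [tsum_mul_left, (NormedSpace.expSeries_div_hasSum_exp (r * z : ℂ)).tsum_eq,
          Complex.exp_eq_exp_ℂ]
    _ = Complex.exp (r * (z - 1)) := by
        rw [Complex.ofReal_exp, ← Complex.exp_add]
        congr 1
        push_cast
        ring

lemma prod_ite_mem_eq_pow (x : ℕ → AoINetwork.Plane) (B : Set AoINetwork.Plane)
    [DecidablePred (· ∈ B)] (z : ℂ) (M : ℕ) :
    ∏ j ∈ Finset.range M, (if x j ∈ B then z else 1)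
      = z ^ ((Finset.range M).filter (fun j => x j ∈ B)).card := by
  rw [Finset.prod_ite, Finset.prod_const, Finset.prod_const_one, mul_one]

/-- The factors of a configuration with finitely many points in `B` eventually produce the power
given by the number of these points. -/
lemma tendsto_prod_ite_mem (x : ℕ → AoINetwork.Plane) (B : Set AoINetwork.Plane)
    [DecidablePred (· ∈ B)] (z : ℂ) (h : AoINetwork.pointCount x B ≠ ⊤) :
    Tendsto (fun M => ∏ j ∈ Finset.range M, (if x j ∈ B then z else 1)) atTop
      (𝓝 (z ^ (AoINetwork.pointCount x B).toNat)) := by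
  have hfin : {j : ℕ | x j ∈ B}.Finite := by
    rw [← encard_ne_top_iff]; exact h
  obtain ⟨N, hN⟩ := hfin.bddAbove
  refine tendsto_const_nhds.congr' ?_
  filter_upwards [eventually_gt_atTop N] with M hM
  rw [prod_ite_mem_eq_pow]
  congr 1
  have : {j : ℕ | x j ∈ B} = (((Finset.range M).filter (fun j => x j ∈ B) : Finset ℕ) : Set ℕ) := by
    ext j
    simp only [mem_ofPred_eq, Finset.coe_filter, Finset.mem_range]
    exact ⟨fun hj => ⟨(hN hj).trans_lt hM, hj⟩, fun hj => hj.2⟩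
  rw [AoINetwork.pointCount, this, encard_coe_eq_coe_finsetCard]
  simp

/-- Complex products are `1`-Lipschitz in each factor on the closed unit disc. -/
lemma enorm_prod_sub_prod_le {ι : Type*} (s : Finset ι) (a b : ι → ℂ) (ha : ∀ i, ‖a i‖ ≤ 1)
    (hb : ∀ i, ‖b i‖ ≤ 1) :
    ‖∏ i ∈ s, a i - ∏ i ∈ s, b i‖ₑ ≤ ∑ i ∈ s, ‖a i - b i‖ₑ := by
  classical
  have key : ‖∏ i ∈ s, a i - ∏ i ∈ s, b i‖ ≤ ∑ i ∈ s, ‖a i - b i‖ := by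
    induction s using Finset.induction_on with
    | empty => simp
    | insert i s hi ih =>
      rw [Finset.prod_insert hi, Finset.prod_insert hi, Finset.sum_insert hi]
      have hb' : ‖∏ i ∈ s, b i‖ ≤ 1 := by
        rw [norm_prod]
        exact Finset.prod_le_one (fun i _ => norm_nonneg _) fun i _ => hb i
      calc ‖a i * ∏ i ∈ s, a i - b i * ∏ i ∈ s, b i‖
          = ‖a i * (∏ i ∈ s, a i - ∏ i ∈ s, b i) + (a i - b i) * ∏ i ∈ s, b i‖ := by ring_nf
        _ ≤ ‖a i‖ * ‖∏ i ∈ s, a i - ∏ i ∈ s, b i‖ + ‖a i - b i‖ * ‖∏ i ∈ s, b i‖ := by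
            rw [← norm_mul, ← norm_mul]; exact norm_add_le _ _
        _ ≤ 1 * ∑ i ∈ s, ‖a i - b i‖ + ‖a i - b i‖ * 1 := by
            gcongr
            exact ha i
        _ = _ := by ring
  simp_rw [← ofReal_norm]
  rw [← ENNReal.ofReal_sum_of_nonneg fun i _ => norm_nonneg _]
  exact ENNReal.ofReal_le_ofReal key

namespace AoINetwork.IsPoissonProcess

variable {Ω : Type*} [MeasurableSpace Ω] {X : ℕ → Ω → AoINetwork.Plane} {lam : ℝ} {P : Measure Ω}

lemma tsum_measure_preimage (hX : AoINetwork.IsPoissonProcess X lam P) {B : Set AoINetwork.Plane}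
    (hB : MeasurableSet B) (hfin : volume B ≠ ∞) :
    ∑' j, P (X j ⁻¹' B) = ENNReal.ofReal lam * volume B := by
  have h1 := (hX.hasLaw_count B hB hfin).lintegral_comp (f := fun n : ℕ∞ => (n : ℝ≥0∞))
    (Measurable.of_discrete.aemeasurable)
  rw [lintegral_map .of_discrete .of_discrete] at h1
  simp only [ENat.toENNReal_coe] at h1
  rw [lintegral_natCast_poissonMeasure, ENNReal.coe_toNNReal (by finiteness)] at h1
  rw [← h1]
  have h2 : ∀ ω, ((AoINetwork.pointCount (fun j => X j ω) B : ℕ∞) : ℝ≥0∞)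
      = ∑' j, (X j ⁻¹' B).indicator 1 ω := by
    intro ω
    rw [AoINetwork.pointCount, ← ENNReal.tsum_set_one,
      tsum_subtype {j : ℕ | X j ω ∈ B} (fun _ => (1 : ℝ≥0∞))]
    rfl
  simp_rw [h2]
  rw [lintegral_tsum fun j =>
    (measurable_one.indicator (hX.measurable j hB)).aemeasurable]
  simp_rw [lintegral_indicator_one (hX.measurable _ hB)]

/-- **Campbell's formula**: the intensity measure of the process is `lam` times the area. -/
theorem sum_map_eq (hX : AoINetwork.IsPoissonProcess X lam P) :
    Measure.sum (fun j => P.map (X j)) = ENNReal.ofReal lam • volume := by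
  have hball : ⋃ n : ℕ, Metric.ball (0 : AoINetwork.Plane) n = univ := Metric.iUnion_ball_nat 0
  refine Measure.ext_of_iUnion_eq_univ hball fun n => ?_
  ext B hB
  rw [Measure.restrict_apply hB, Measure.restrict_apply hB,
    Measure.sum_apply _ (hB.inter measurableSet_ball)]
  simp_rw [Measure.map_apply (hX.measurable _) (hB.inter measurableSet_ball)]
  rw [hX.tsum_measure_preimage (hB.inter measurableSet_ball)]
  · rfl
  · exact ((measure_mono inter_subset_right).trans_lt measure_ball_lt_top).ne

theorem lintegral_tsum_comp (hX : AoINetwork.IsPoissonProcess X lam P)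
    {f : AoINetwork.Plane → ℝ≥0∞} (hf : Measurable f) :
    ∫⁻ ω, ∑' j, f (X j ω) ∂P = ENNReal.ofReal lam * ∫⁻ x, f x := by
  rw [lintegral_tsum (f := fun j ω => f (X j ω))
    fun j => (hf.comp (hX.measurable j)).aemeasurable]
  simp_rw [← lintegral_map hf (hX.measurable _)]
  rw [← lintegral_sum_measure, hX.sum_map_eq, lintegral_smul_measure, smul_eq_mul]

lemma ae_pointCount_ne_top (hX : AoINetwork.IsPoissonProcess X lam P) {B : Set AoINetwork.Plane}
    (hB : MeasurableSet B) (hfin : volume B ≠ ∞) :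
    ∀ᵐ ω ∂P, AoINetwork.pointCount (fun j => X j ω) B ≠ ⊤ := by
  rw [(hX.hasLaw_count B hB hfin).ae_iff (p := fun n => n ≠ ⊤) (by fun_prop),
    ae_map_iff (by fun_prop) (.of_discrete)]
  exact ae_of_all _ fun n => ENat.natCast_ne_top n

lemma integral_pow_pointCount (hX : AoINetwork.IsPoissonProcess X lam P)
    {B : Set AoINetwork.Plane} (hB : MeasurableSet B) (hfin : volume B ≠ ∞) (hlam : 0 ≤ lam)
    (z : ℂ) :
    ∫ ω, z ^ (AoINetwork.pointCount (fun j => X j ω) B).toNat ∂P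
      = Complex.exp (-(lam * (volume.real B * (1 - z)))) := by
  have h := (hX.hasLaw_count B hB hfin).integral_comp (f := fun n : ℕ∞ => z ^ n.toNat)
    (Measurable.of_discrete.aestronglyMeasurable)
  rw [Function.comp_def, integral_map Measurable.of_discrete.aemeasurable
    Measurable.of_discrete.aestronglyMeasurable] at h
  rw [h]
  simp only [ENat.toNat_natCast]
  rw [integral_pow_poissonMeasure]
  congr 1
  have : ((((ENNReal.ofReal lam * volume B).toNNReal : ℝ≥0) : ℝ) : ℂ) = lam * volume.real B := by
    rw [ENNReal.coe_toNNReal_eq_toReal, ENNReal.toReal_mul, ENNReal.toReal_ofReal hlam]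
    push_cast
    rfl
  rw [this]
  ring

variable [IsProbabilityMeasure P]

/-- The generating functional at a function that differs from `1` by a simple function: the
counts in its level sets are independent Poisson variables. -/
lemma tendsto_integral_prod_one_sub_simpleFunc (hX : AoINetwork.IsPoissonProcess X lam P)
    (hlam : 0 ≤ lam) (f : SimpleFunc AoINetwork.Plane ℂ) (hf : Integrable f volume)
    (hf1 : ∀ x, ‖1 - f x‖ ≤ 1) :
    Tendsto (fun M => ∫ ω, ∏ j ∈ Finset.range M, (1 - f (X j ω)) ∂P) atTop
      (𝓝 (Complex.exp (-(lam * ∫ x, f x)))) := by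
  classical
  set T : Finset ℂ := {c ∈ f.range | c ≠ 0} with hT
  set v : Fin T.card → ℂ := fun i => (T.equivFin.symm i : ℂ) with hv
  set B : Fin T.card → Set AoINetwork.Plane := fun i => f ⁻¹' {v i} with hBdef
  have hvT : ∀ i, v i ∈ T := fun i => (T.equivFin.symm i).2
  have hv0 : ∀ i, v i ≠ 0 := fun i => (Finset.mem_filter.1 (hvT i)).2
  have hBm : ∀ i, MeasurableSet (B i) := fun i => f.measurableSet_preimage _
  have hBfin : ∀ i, volume (B i) ≠ ∞ := fun i =>
    (f.measure_preimage_lt_top_of_integrable hf (hv0 i)).ne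
  have hdisj : Pairwise (fun i i' => Disjoint (B i) (B i')) := by
    intro i i' hii
    refine Disjoint.preimage _ (disjoint_singleton.2 fun h => hii ?_)
    exact T.equivFin.symm.injective (Subtype.ext h)
  have hv1 : ∀ i, ‖1 - v i‖ ≤ 1 := by
    intro i
    obtain ⟨x, hx⟩ := SimpleFunc.mem_range.1 (Finset.mem_filter.1 (hvT i)).1
    rw [← hx]; exact hf1 x
  have hfac : ∀ x, 1 - f x = ∏ i, (if x ∈ B i then 1 - v i else 1) := by
    intro x
    have h1 : ∏ i, (if x ∈ B i then 1 - v i else 1)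
        = ∏ c : T, (if f x = c then 1 - (c : ℂ) else 1) :=
      T.equivFin.symm.prod_comp (fun c : T => if f x = c then 1 - (c : ℂ) else 1)
    rw [h1, Finset.prod_coe_sort T (fun c => if f x = c then 1 - c else 1), Finset.prod_ite_eq]
    split_ifs with h
    · rfl
    · have : f x = 0 := by
        by_contra h0
        exact h (Finset.mem_filter.2 ⟨f.mem_range_self x, h0⟩)
      simp [this]
  have hswap : ∀ M ω, ∏ j ∈ Finset.range M, (1 - f (X j ω))
      = ∏ i, ∏ j ∈ Finset.range M, (if X j ω ∈ B i then 1 - v i else 1) := by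
    intro M ω
    simp_rw [hfac]
    exact Finset.prod_comm
  have hlim : Tendsto (fun M => ∫ ω, ∏ j ∈ Finset.range M, (1 - f (X j ω)) ∂P) atTop
      (𝓝 (∫ ω, ∏ i, (1 - v i) ^ (AoINetwork.pointCount (fun j => X j ω) (B i)).toNat ∂P)) := by
    refine tendsto_integral_of_dominated_convergence (fun _ => 1) (fun M => ?_)
      (integrable_const _) (fun M => ae_of_all _ fun ω => ?_) ?_
    · refine Measurable.aestronglyMeasurable ?_
      exact Finset.measurable_fun_prod _ fun j _ =>
        measurable_const.sub (f.measurable.comp (hX.measurable j))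
    · rw [norm_prod]
      exact Finset.prod_le_one (fun i _ => norm_nonneg _) fun j _ => hf1 _
    · have : ∀ᵐ ω ∂P, ∀ i, AoINetwork.pointCount (fun j => X j ω) (B i) ≠ ⊤ :=
        ae_all_iff.2 fun i => hX.ae_pointCount_ne_top (hBm i) (hBfin i)
      refine this.mono fun ω hω => ?_
      simp_rw [hswap]
      exact tendsto_finsetProd _ fun i _ => tendsto_prod_ite_mem _ _ _ (hω i)
  convert hlim using 2
  have hind := hX.indep_count _ B hBm hBfin hdisj
  rw [hind.integral_fun_prod_comp (f := fun i n => (1 - v i) ^ n.toNat)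
    (fun i => (hX.hasLaw_count _ (hBm i) (hBfin i)).aemeasurable)
    (fun i => Measurable.of_discrete.aestronglyMeasurable)]
  simp_rw [hX.integral_pow_pointCount (hBm _) (hBfin _) hlam, sub_sub_cancel]
  rw [← Complex.exp_sum, Finset.sum_neg_distrib, ← Finset.mul_sum]
  congr 3
  rw [← SimpleFunc.integral_eq_integral f hf, SimpleFunc.integral_eq_sum_filter]
  have h1 : ∑ i, (volume.real (B i) : ℂ) * v i = ∑ c : T, (volume.real (f ⁻¹' {(c : ℂ)}) : ℂ) * c :=
    T.equivFin.symm.sum_comp (fun c : T => (volume.real (f ⁻¹' {(c : ℂ)}) : ℂ) * c)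
  rw [h1, Finset.sum_coe_sort T (fun c => (volume.real (f ⁻¹' {c}) : ℂ) * c)]
  rfl

/-- **Probability generating functional** of the Poisson process for complex functions with values
in the closed unit disc. The products converge in mean, so no infinite product is needed. -/
theorem tendsto_integral_prod (hX : AoINetwork.IsPoissonProcess X lam P)
    (hlam : 0 ≤ lam) {g : AoINetwork.Plane → ℂ} (hg : Measurable g) (hg1 : ∀ x, ‖g x‖ ≤ 1)
    (hgi : Integrable (fun x => 1 - g x) volume) :
    Tendsto (fun M => ∫ ω, ∏ j ∈ Finset.range M, g (X j ω) ∂P) atTop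
      (𝓝 (Complex.exp (-(lam * ∫ x, (1 - g x))))) := by
  set f : AoINetwork.Plane → ℂ := fun x => 1 - g x with hfdef
  have hf : Measurable f := measurable_const.sub hg
  -- the approximating simple functions keep `1 - f` in the closed unit disc
  set s : Set ℂ := {z | ‖1 - z‖ ≤ 1} with hs
  have h0 : (0 : ℂ) ∈ s := by simp [hs]
  have hfs : ∀ x, f x ∈ s := fun x => by simpa [hs, hfdef] using hg1 x
  set F : ℕ → SimpleFunc AoINetwork.Plane ℂ := fun n => SimpleFunc.approxOn f hf s 0 h0 n with hF
  have hFs : ∀ n x, ‖1 - F n x‖ ≤ 1 := fun n x => SimpleFunc.approxOn_mem hf h0 n x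
  have hFi : ∀ n, Integrable (F n) volume := fun n =>
    SimpleFunc.integrable_approxOn hf hgi h0 (integrable_zero _ _ _) n
  have hL1 : Tendsto (fun n => ∫⁻ x, ‖F n x - f x‖ₑ) atTop (𝓝 0) :=
    SimpleFunc.tendsto_approxOn_L1_enorm hf h0 (ae_of_all _ fun x => subset_closure (hfs x))
      (by simpa using hgi.2)
  have hint : Tendsto (fun n => ∫ x, F n x) atTop (𝓝 (∫ x, f x)) :=
    tendsto_integral_of_L1 f hf.aestronglyMeasurable (Eventually.of_forall hFi) hL1
  have hbound : ∀ n M, ‖(∫ ω, ∏ j ∈ Finset.range M, g (X j ω) ∂P)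
      - ∫ ω, ∏ j ∈ Finset.range M, (1 - F n (X j ω)) ∂P‖ₑ
        ≤ ENNReal.ofReal lam * ∫⁻ x, ‖F n x - f x‖ₑ := by
    intro n M
    have hm1 : Measurable fun ω => ∏ j ∈ Finset.range M, g (X j ω) :=
      Finset.measurable_fun_prod _ fun j _ => hg.comp (hX.measurable j)
    have hm2 : Measurable fun ω => ∏ j ∈ Finset.range M, (1 - F n (X j ω)) :=
      Finset.measurable_fun_prod _ fun j _ =>
        measurable_const.sub ((F n).measurable.comp (hX.measurable j))
    have hb1 : ∀ ω, ‖∏ j ∈ Finset.range M, g (X j ω)‖ ≤ 1 := fun ω => by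
      rw [norm_prod]
      exact Finset.prod_le_one (fun i _ => norm_nonneg _) fun j _ => hg1 _
    have hb2 : ∀ ω, ‖∏ j ∈ Finset.range M, (1 - F n (X j ω))‖ ≤ 1 := fun ω => by
      rw [norm_prod]
      exact Finset.prod_le_one (fun i _ => norm_nonneg _) fun j _ => hFs n _
    rw [← integral_sub (Integrable.of_bound hm1.aestronglyMeasurable 1 (ae_of_all _ hb1))
      (Integrable.of_bound hm2.aestronglyMeasurable 1 (ae_of_all _ hb2))]
    refine (enorm_integral_le_lintegral_enorm _).trans ?_
    rw [← hX.lintegral_tsum_comp (f := fun x => ‖F n x - f x‖ₑ) (((F n).measurable.sub hf).enorm)]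
    refine lintegral_mono fun ω => ?_
    refine (enorm_prod_sub_prod_le _ _ _ (fun j => hg1 _) (fun j => hFs n _)).trans ?_
    refine (Finset.sum_le_sum fun j _ => le_of_eq ?_).trans (ENNReal.sum_le_tsum (Finset.range M))
    simp only [hfdef]
    congr 1
    ring
  have hunif : TendstoUniformly
      (fun n M => ∫ ω, ∏ j ∈ Finset.range M, (1 - F n (X j ω)) ∂P)
      (fun M => ∫ ω, ∏ j ∈ Finset.range M, g (X j ω) ∂P) atTop := by
    rw [EMetric.tendstoUniformly_iff]
    intro ε hε
    have h2 : Tendsto (fun n => ENNReal.ofReal lam * ∫⁻ x, ‖F n x - f x‖ₑ) atTop (𝓝 0) := by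
      simpa using ENNReal.Tendsto.const_mul hL1 (Or.inr ENNReal.ofReal_ne_top)
    filter_upwards [h2.eventually (gt_mem_nhds hε)] with n hn M
    rw [edist_eq_enorm_sub]
    exact (hbound n M).trans_lt hn
  refine hunif.tendsto_of_eventually_tendsto
    (Eventually.of_forall fun n =>
      hX.tendsto_integral_prod_one_sub_simpleFunc hlam (F n) (hFi n) (hFs n)) ?_
  exact (Complex.continuous_exp.tendsto _).comp ((hint.const_mul (lam : ℂ)).neg)

end AoINetwork.IsPoissonProcess

/-! ### The binomial series -/

/-- `log (1 - a)` as the exponent of the complex power `(1 - a) ^ (jω)`. -/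
lemma one_sub_cpow_I_mul (w : ℝ) {a : ℝ} (ha : a < 1) :
    (1 + (-(a : ℂ))) ^ (Complex.I * (w : ℂ))
      = Complex.exp (Complex.I * (w * Real.log (1 - a) : ℝ)) := by
  have h : (1 + (-(a : ℂ))) = ((1 - a : ℝ) : ℂ) := by push_cast; ring
  rw [h, Complex.cpow_def_of_ne_zero (by exact_mod_cast (by linarith : (1 - a) ≠ 0)),
    ← Complex.ofReal_log (by linarith)]
  push_cast
  ring_nf

lemma summable_norm_choose_mul_pow (z : ℂ) {q : ℝ} (hq0 : 0 ≤ q) (hq1 : q < 1) :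
    Summable fun k : ℕ => ‖Ring.choose z k‖ * q ^ k := by
  lift q to ℝ≥0 using hq0
  have h := (binomialSeries ℂ z).summable_norm_mul_pow (r := q)
    (lt_of_lt_of_le (by exact_mod_cast hq1) binomialSeries_radius_ge_one)
  simpa [binomialSeries, FormalMultilinearSeries.ofScalars_norm] using h

/-- Newton's binomial series of `1 - (1 - a)^{jω}`, without the constant term. -/
lemma hasSum_choose_mul_pow_of_lt_one (w : ℝ) {a : ℝ} (ha0 : 0 ≤ a) (ha : a < 1) :
    HasSum (fun k : ℕ => Ring.choose (Complex.I * (w : ℂ)) (k + 1) *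
      ((-1) ^ (k + 1 + 1) * a ^ (k + 1)))
      (1 - Complex.exp (Complex.I * (w * Real.log (1 - a) : ℝ))) := by
  have hmem : (-(a : ℂ)) ∈ Metric.eball (0 : ℂ) 1 := by
    rw [mem_eball_zero_iff, enorm_neg, ← ofReal_norm, Complex.norm_real, Real.norm_of_nonneg ha0]
    simpa using ha
  have h := (Complex.one_add_cpow_hasFPowerSeriesOnBall_zero (a := Complex.I * w)).hasSum hmem
  simp only [binomialSeries_apply, List.ofFn_const, List.prod_replicate, smul_eq_mul, zero_add] at h
  rw [one_sub_cpow_I_mul w ha] at h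
  have h2 := ((hasSum_nat_add_iff' 1).2 h).neg
  simp only [Finset.sum_range_one, Ring.choose_zero_right, pow_zero, mul_one, neg_sub] at h2
  refine h2.congr_fun fun k => ?_
  rw [neg_pow (a : ℂ)]
  ring

namespace AoINetwork

/-! ### Path loss, activity and the radial change of variables -/

/-- The received power from a transmitter at `x` relative to the typical link, scaled by the
threshold: `θ r^α ‖x‖^(-α)`. At `x = 0` it takes the junk value `0`, which is almost surely
irrelevant. -/
noncomputable def relGain (prm : NetworkParams) (x : Plane) : ℝ :=
  prm.theta * prm.r ^ prm.alpha * ‖x‖ ^ (-prm.alpha)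

/-- The probability `s / (1 + s)` that an active interferer at `x` alone would defeat a transmission
in the absence of noise, where `s = relGain prm x`. -/
noncomputable def blockProb (prm : NetworkParams) (x : Plane) : ℝ :=
  relGain prm x / (1 + relGain prm x)

/-- `blockProb` as a function of the normalized squared distance `v = ‖x‖² / (r² θ^δ)`. -/
noncomputable def radialBlockProb (prm : NetworkParams) (v : ℝ) : ℝ := 1 / (1 + v ^ (prm.alpha / 2))

/-- Stationary probability that a node whose packets are delivered with probability `m` is
transmitting. The success probability is clamped to `[0, 1]`, so that no assumption on `m` is
needed. -/
noncomputable def activity (prm : NetworkParams) (m : ℝ) : ℝ :=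
  prm.p * prm.xi / (prm.xi + (1 - prm.xi) * prm.p * max 0 (min m 1))

variable (prm : NetworkParams)

lemma relGain_nonneg (x : Plane) : 0 ≤ relGain prm x := by
  have := prm.theta_pos; have := prm.r_pos
  unfold relGain; positivity

lemma blockProb_nonneg (x : Plane) : 0 ≤ blockProb prm x := by
  have := relGain_nonneg prm x
  unfold blockProb; positivity

lemma blockProb_lt_one (x : Plane) : blockProb prm x < 1 := by
  have := relGain_nonneg prm x
  unfold blockProb
  rw [div_lt_one (by linarith)]; linarith

lemma measurable_blockProb : Measurable (blockProb prm) := by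
  unfold blockProb relGain; fun_prop

lemma radialBlockProb_pos {v : ℝ} (hv : 0 ≤ v) : 0 < radialBlockProb prm v := by
  unfold radialBlockProb; positivity

lemma radialBlockProb_le_one {v : ℝ} (hv : 0 ≤ v) : radialBlockProb prm v ≤ 1 := by
  have : 0 ≤ v ^ (prm.alpha / 2) := by positivity
  unfold radialBlockProb
  rw [div_le_one (by linarith)]; linarith

lemma measurable_radialBlockProb : Measurable (radialBlockProb prm) := by
  unfold radialBlockProb; fun_prop

lemma activity_denom_mem (m : ℝ) :
    prm.xi ≤ prm.xi + (1 - prm.xi) * prm.p * max 0 (min m 1) ∧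
      prm.xi + (1 - prm.xi) * prm.p * max 0 (min m 1) ≤ 1 := by
  have h1 := prm.xi_pos; have h2 := prm.xi_le_one
  have h3 := prm.p_pos; have h4 := prm.p_lt_one
  have h5 : 0 ≤ max 0 (min m 1) := le_max_left _ _
  have h6 : max 0 (min m 1) ≤ 1 := max_le zero_le_one (min_le_right _ _)
  have h7 : 0 ≤ (1 - prm.xi) * prm.p := mul_nonneg (by linarith) h3.le
  refine ⟨by nlinarith [mul_nonneg h7 h5], ?_⟩
  have h8 : (1 - prm.xi) * prm.p * max 0 (min m 1) ≤ (1 - prm.xi) * prm.p * 1 :=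
    mul_le_mul_of_nonneg_left h6 h7
  nlinarith [mul_nonneg (sub_nonneg.2 h2) (sub_nonneg.2 h4.le)]

lemma activity_pos (m : ℝ) : 0 < activity prm m := by
  have h1 := prm.xi_pos; have h3 := prm.p_pos
  have := (activity_denom_mem prm m).1
  unfold activity
  exact div_pos (by positivity) (by linarith)

lemma activity_le (m : ℝ) : activity prm m ≤ prm.p := by
  have h1 := prm.xi_pos; have h3 := prm.p_pos
  have := (activity_denom_mem prm m).1
  unfold activity
  rw [div_le_iff₀ (by linarith)]
  exact mul_le_mul_of_nonneg_left this h3.le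

lemma le_activity (m : ℝ) : prm.p * prm.xi ≤ activity prm m := by
  have h1 := prm.xi_pos; have h3 := prm.p_pos
  have := activity_denom_mem prm m
  unfold activity
  exact le_div_self (by positivity) (by linarith) this.2

lemma measurable_activity : Measurable (activity prm) := by
  unfold activity; fun_prop

lemma activity_mul_mem (m : ℝ) {d : ℝ} (hd0 : 0 ≤ d) (hd1 : d ≤ 1) :
    0 ≤ activity prm m * d ∧ activity prm m * d ≤ prm.p * d ∧ activity prm m * d < 1 := by
  have h1 := activity_pos prm m
  have h2 := activity_le prm m
  have h3 := prm.p_lt_one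
  refine ⟨by positivity, by gcongr, ?_⟩
  calc activity prm m * d ≤ activity prm m * 1 := by gcongr
    _ < 1 := by linarith

/-- For `a = q d ≤ p` one has `-log (1 - a) ≤ a / (1 - a) ≤ a / (1 - p)`. -/
lemma abs_log_one_sub_mul_le {q d : ℝ} (hq0 : 0 ≤ q) (hq : q ≤ prm.p) (hd0 : 0 ≤ d) (hd1 : d ≤ 1) :
    |Real.log (1 - q * d)| ≤ prm.p / (1 - prm.p) * d := by
  have hp := prm.p_lt_one; have hp0 := prm.p_pos
  have h1 : 0 ≤ q * d := mul_nonneg hq0 hd0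
  have h2 : q * d ≤ prm.p * d := mul_le_mul_of_nonneg_right hq hd0
  set a := q * d with ha
  have hap : a ≤ prm.p := h2.trans (mul_le_of_le_one_right hp0.le hd1)
  rw [abs_of_nonpos (Real.log_nonpos (by linarith) (by linarith))]
  have h4 := Real.one_sub_inv_le_log_of_pos (show 0 < 1 - a by linarith)
  calc -Real.log (1 - a) ≤ (1 - a)⁻¹ - 1 := by linarith
    _ = a / (1 - a) := by
        have : 1 - a ≠ 0 := by linarith
        field_simp; ring
    _ ≤ (prm.p * d) / (1 - prm.p) := by
        apply div_le_div₀ (by positivity) h2 (by linarith) (by linarith)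
    _ = _ := by ring

lemma abs_log_one_sub_activity_mul_le (m : ℝ) {d : ℝ} (hd0 : 0 ≤ d) (hd1 : d ≤ 1) :
    |Real.log (1 - activity prm m * d)| ≤ prm.p / (1 - prm.p) * d :=
  abs_log_one_sub_mul_le prm (activity_pos prm m).le (activity_le prm m) hd0 hd1

lemma le_abs_log_one_sub_activity_mul (m : ℝ) {d : ℝ} (hd0 : 0 ≤ d) (hd1 : d ≤ 1) :
    prm.p * prm.xi * d ≤ |Real.log (1 - activity prm m * d)| := by
  obtain ⟨h1, h2, h3⟩ := activity_mul_mem prm m hd0 hd1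
  rw [abs_of_nonpos (Real.log_nonpos (by linarith) (by linarith))]
  have h4 := Real.log_le_sub_one_of_pos (show 0 < 1 - activity prm m * d by linarith)
  have h5 := mul_le_mul_of_nonneg_right (le_activity prm m) hd0
  linarith

/-- The normalization `r² θ^δ` of squared distances. -/
noncomputable def areaScale : ℝ := prm.r ^ 2 * prm.theta ^ prm.delta

lemma areaScale_pos : 0 < areaScale prm := by
  have := prm.theta_pos; have := prm.r_pos
  unfold areaScale; positivity

lemma areaScale_rpow : areaScale prm ^ (prm.alpha / 2) = prm.theta * prm.r ^ prm.alpha := by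
  have h1 := prm.theta_pos; have h2 := prm.r_pos
  have h3 : prm.alpha ≠ 0 := by linarith [prm.two_lt_alpha]
  unfold areaScale NetworkParams.delta
  rw [Real.mul_rpow (by positivity) (by positivity), ← Real.rpow_natCast, ← Real.rpow_mul h2.le,
    ← Real.rpow_mul h1.le]
  have e1 : ((2 : ℕ) : ℝ) * (prm.alpha / 2) = prm.alpha := by push_cast; ring
  have e2 : 2 / prm.alpha * (prm.alpha / 2) = 1 := by field_simp
  rw [e1, e2, Real.rpow_one, mul_comm]

/-- `blockProb` in terms of the distance `y`, in the normalized variable `v = y² / (r² θ^δ)`. -/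
lemma relGain_div_eq_radialBlockProb {y : ℝ} (hy : 0 < y) :
    prm.theta * prm.r ^ prm.alpha * y ^ (-prm.alpha)
        / (1 + prm.theta * prm.r ^ prm.alpha * y ^ (-prm.alpha))
      = radialBlockProb prm ((areaScale prm)⁻¹ * y ^ (2 : ℝ)) := by
  have h1 := prm.theta_pos; have h2 := prm.r_pos
  have hs := areaScale_pos prm
  unfold radialBlockProb
  rw [Real.mul_rpow (by positivity) (by positivity), Real.inv_rpow hs.le, areaScale_rpow,
    ← Real.rpow_mul hy.le, show (2 : ℝ) * (prm.alpha / 2) = prm.alpha by ring,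
    Real.rpow_neg hy.le]
  have : 0 < y ^ prm.alpha := by positivity
  have : 0 < prm.r ^ prm.alpha := by positivity
  field_simp
  ring

variable {E : Type*} [NormedAddCommGroup E] [NormedSpace ℝ E]

/-- Polar coordinates: the image of the area measure in the variable `v = ‖x‖² / (r² θ^δ)` is
`π r² θ^δ dv`. -/
lemma integral_comp_blockProb (f : ℝ → E) :
    ∫ x, f (blockProb prm x)
      = (Real.pi * areaScale prm) • ∫ v in Ioi (0 : ℝ), f (radialBlockProb prm v) := by
  have hs := areaScale_pos prm
  have h1 := integral_fun_norm_addHaar (volume : Measure Plane) (fun y : ℝ =>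
    f (prm.theta * prm.r ^ prm.alpha * y ^ (-prm.alpha)
        / (1 + prm.theta * prm.r ^ prm.alpha * y ^ (-prm.alpha))))
  have h2 : ∀ x : Plane, f (blockProb prm x) = f (prm.theta * prm.r ^ prm.alpha * ‖x‖ ^ (-prm.alpha)
        / (1 + prm.theta * prm.r ^ prm.alpha * ‖x‖ ^ (-prm.alpha))) := fun x => rfl
  simp_rw [h2]
  rw [h1]
  have hball : (volume : Measure Plane).real (Metric.ball 0 1) = Real.pi := by
    rw [Measure.real, EuclideanSpace.volume_ball_fin_two]
    simp [Real.pi_pos.le]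
  have h3 := integral_comp_rpow_Ioi_of_pos (E := E)
    (g := fun z => f (radialBlockProb prm ((areaScale prm)⁻¹ * z))) (p := 2) two_pos
  have h4 := integral_comp_mul_left_Ioi (fun z => f (radialBlockProb prm z)) 0 (inv_pos.2 hs)
  rw [mul_zero, inv_inv] at h4
  rw [h4] at h3
  rw [hball, mul_smul, ← h3, finrank_euclideanSpace_fin]
  have h5 : ∫ y in Ioi (0 : ℝ), ((2 : ℝ) * y ^ ((2 : ℝ) - 1)) •
      f (radialBlockProb prm ((areaScale prm)⁻¹ * y ^ (2 : ℝ)))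
      = (2 : ℝ) • ∫ y in Ioi (0 : ℝ), y ^ (2 - 1) •
        f (prm.theta * prm.r ^ prm.alpha * y ^ (-prm.alpha)
          / (1 + prm.theta * prm.r ^ prm.alpha * y ^ (-prm.alpha))) := by
    rw [← integral_smul]
    refine setIntegral_congr_fun measurableSet_Ioi fun y (hy : 0 < y) => ?_
    rw [relGain_div_eq_radialBlockProb prm hy, smul_smul]
    norm_num
  rw [h5, ← Nat.cast_smul_eq_nsmul ℝ, smul_smul, smul_smul]
  push_cast
  ring_nf

lemma integrableOn_radialBlockProb : IntegrableOn (radialBlockProb prm) (Ioi 0) := by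
  have hα := prm.two_lt_alpha
  rw [← Ioc_union_Ioi_eq_Ioi (zero_le_one' ℝ)]
  refine IntegrableOn.union ?_ ?_
  · refine Measure.integrableOn_of_bounded (M := 1) (by simp)
      (measurable_radialBlockProb prm).aestronglyMeasurable ?_
    refine (ae_restrict_mem measurableSet_Ioc).mono fun v hv => ?_
    rw [Real.norm_of_nonneg (radialBlockProb_pos prm hv.1.le).le]
    exact radialBlockProb_le_one prm hv.1.le
  · refine Integrable.mono' (integrableOn_Ioi_rpow_of_lt (a := -(prm.alpha / 2)) (by linarith)
      zero_lt_one) (measurable_radialBlockProb prm).aestronglyMeasurable ?_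
    refine (ae_restrict_mem measurableSet_Ioi).mono fun v (hv : 1 < v) => ?_
    have hv0 : 0 < v := by linarith
    rw [Real.norm_of_nonneg (radialBlockProb_pos prm hv0.le).le, Real.rpow_neg hv0.le]
    unfold radialBlockProb
    rw [one_div]
    have : 0 < v ^ (prm.alpha / 2) := by positivity
    exact inv_anti₀ this (by linarith)

lemma integrable_blockProb : Integrable (blockProb prm) := by
  have hs := areaScale_pos prm
  have h1 := integrable_fun_norm_addHaar (volume : Measure Plane) (f := fun y : ℝ =>
    prm.theta * prm.r ^ prm.alpha * y ^ (-prm.alpha)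
        / (1 + prm.theta * prm.r ^ prm.alpha * y ^ (-prm.alpha)))
  refine h1.2 ?_
  have h2 : IntegrableOn (fun z => radialBlockProb prm ((areaScale prm)⁻¹ * z)) (Ioi 0) := by
    rw [integrableOn_Ioi_comp_mul_left_iff _ _ (inv_pos.2 hs), mul_zero]
    exact integrableOn_radialBlockProb prm
  rw [← integrableOn_Ioi_comp_rpow_iff' _ (p := 2) two_ne_zero] at h2
  refine h2.congr_fun (fun y (hy : 0 < y) => ?_) measurableSet_Ioi
  simp only
  rw [relGain_div_eq_radialBlockProb prm hy, finrank_euclideanSpace_fin]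
  norm_num

/-- The blocking probabilities of the points of a Poisson process are almost surely summable. -/
lemma ae_summable_blockProb {Ω : Type*} [MeasurableSpace Ω] {P : Measure Ω} {X : ℕ → Ω → Plane}
    {lam : ℝ} (hX : IsPoissonProcess X lam P) :
    ∀ᵐ ω ∂P, Summable fun j => blockProb prm (X j ω) := by
  have hm : Measurable fun x => ENNReal.ofReal (blockProb prm x) :=
    (measurable_blockProb prm).ennreal_ofReal
  have h1 := hX.lintegral_tsum_comp hm
  have h2 : ∫⁻ x, ENNReal.ofReal (blockProb prm x) ≠ ∞ :=
    ((hasFiniteIntegral_iff_ofReal (ae_of_all _ (blockProb_nonneg prm))).1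
      (integrable_blockProb prm).2).ne
  have h3 : ∀ᵐ ω ∂P, ∑' j, ENNReal.ofReal (blockProb prm (X j ω)) < ∞ := by
    refine ae_lt_top (Measurable.tsum fun j => hm.comp (hX.measurable j)) ?_
    rw [h1]
    exact ENNReal.mul_ne_top ENNReal.ofReal_ne_top h2
  refine h3.mono fun ω hω => ?_
  have := ENNReal.summable_toReal hω.ne
  simpa [ENNReal.toReal_ofReal (blockProb_nonneg prm _)] using this

end AoINetwork

/-! ### The exponent of the characteristic function -/

namespace AoINetwork

variable (prm : NetworkParams) (law : Measure ℝ)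

/-- The average over the mark `m` of `1 - (1 - a)^{jω}`, where `a = activity m * d`. -/
noncomputable def markDefect (w d : ℝ) : ℂ :=
  ∫ m, (1 - Complex.exp (Complex.I * (w * Real.log (1 - activity prm m * d) : ℝ))) ∂law

/-- The exponent `∫₀^∞ E[1 - (1 - activity(m) / (1 + v^{α/2}))^{jω}] dv`. -/
noncomputable def radialExponent (w : ℝ) : ℂ :=
  ∫ v in Ioi (0 : ℝ), markDefect prm law w (radialBlockProb prm v)

lemma norm_exp_I_mul_ofReal (x : ℝ) : ‖Complex.exp (Complex.I * (x : ℂ))‖ = 1 := by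
  rw [mul_comm, Complex.norm_exp_ofReal_mul_I]

lemma norm_one_sub_exp_I_mul_log_le (w m : ℝ) {d : ℝ} (hd0 : 0 ≤ d) (hd1 : d ≤ 1) :
    ‖1 - Complex.exp (Complex.I * (w * Real.log (1 - activity prm m * d) : ℝ))‖
      ≤ |w| * (prm.p / (1 - prm.p)) * d := by
  rw [norm_sub_rev]
  refine Real.norm_exp_I_mul_ofReal_sub_one_le.trans ?_
  rw [norm_mul, Real.norm_eq_abs, Real.norm_eq_abs, mul_assoc]
  gcongr
  exact abs_log_one_sub_activity_mul_le prm m hd0 hd1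

lemma measurable_exp_I_mul_log (w : ℝ) : Measurable fun q : ℝ × ℝ =>
    Complex.exp (Complex.I * (w * Real.log (1 - activity prm q.2 * q.1) : ℝ)) := by
  have := measurable_activity prm
  have h : Measurable fun q : ℝ × ℝ => w * Real.log (1 - activity prm q.2 * q.1) :=
    (Real.measurable_log.comp (measurable_const.sub
      ((this.comp measurable_snd).mul measurable_fst))).const_mul w
  exact Complex.measurable_exp.comp ((Complex.measurable_ofReal.comp h).const_mul _)

variable [IsProbabilityMeasure law]

lemma integrable_exp_I_mul_log (w d : ℝ) : Integrable (fun m =>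
    Complex.exp (Complex.I * (w * Real.log (1 - activity prm m * d) : ℝ))) law :=
  Integrable.of_bound (C := 1)
    ((measurable_exp_I_mul_log prm w).comp measurable_prodMk_left).aestronglyMeasurable
    (ae_of_all _ fun _ => (norm_exp_I_mul_ofReal _).le)

lemma norm_markDefect_le (w : ℝ) {d : ℝ} (hd0 : 0 ≤ d) (hd1 : d ≤ 1) :
    ‖markDefect prm law w d‖ ≤ |w| * (prm.p / (1 - prm.p)) * d := by
  unfold markDefect
  refine (norm_integral_le_of_norm_le_const (ae_of_all _ fun m =>
    norm_one_sub_exp_I_mul_log_le prm w m hd0 hd1)).trans ?_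
  simp

lemma measurable_markDefect (w : ℝ) : Measurable (markDefect prm law w) := by
  have h : StronglyMeasurable (fun q : ℝ × ℝ =>
    1 - Complex.exp (Complex.I * (w * Real.log (1 - activity prm q.2 * q.1) : ℝ))) :=
    (measurable_const.sub (measurable_exp_I_mul_log prm w)).stronglyMeasurable
  exact h.integral_prod_right.measurable

lemma integrableOn_markDefect_radialBlockProb (w : ℝ) :
    IntegrableOn (fun v => markDefect prm law w (radialBlockProb prm v)) (Ioi 0) := by
  refine Integrable.mono' ((integrableOn_radialBlockProb prm).const_mul
    (|w| * (prm.p / (1 - prm.p))))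
    ((measurable_markDefect prm law w).comp (measurable_radialBlockProb prm)).aestronglyMeasurable ?_
  refine (ae_restrict_mem measurableSet_Ioi).mono fun v (hv : 0 < v) => ?_
  exact norm_markDefect_le prm law w (radialBlockProb_pos prm hv.le).le
    (radialBlockProb_le_one prm hv.le)

lemma integrable_markDefect_blockProb (w : ℝ) :
    Integrable (fun x => markDefect prm law w (blockProb prm x)) := by
  refine Integrable.mono' ((integrable_blockProb prm).const_mul
    (|w| * (prm.p / (1 - prm.p))))
    ((measurable_markDefect prm law w).comp (measurable_blockProb prm)).aestronglyMeasurable ?_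
  exact ae_of_all _ fun x => norm_markDefect_le prm law w (blockProb_nonneg prm x)
    (blockProb_lt_one prm x).le

lemma pathLossIntegrand_eq (k : ℕ) (v : ℝ) :
    pathLossIntegrand prm k v = (-1) ^ (k + 1) * radialBlockProb prm v ^ k := by
  unfold pathLossIntegrand radialBlockProb
  rw [one_div, inv_pow, div_eq_mul_inv]

lemma abs_pathLossIntegrand_succ_le (k : ℕ) {v : ℝ} (hv : 0 ≤ v) :
    |pathLossIntegrand prm (k + 1) v| ≤ radialBlockProb prm v := by
  have h0 := radialBlockProb_pos prm hv
  rw [pathLossIntegrand_eq, abs_mul, abs_pow, abs_neg, abs_one, one_pow, one_mul, abs_pow,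
    abs_of_pos h0, pow_succ]
  exact mul_le_of_le_one_left h0.le (pow_le_one₀ h0.le (radialBlockProb_le_one prm hv))

lemma measurable_pathLossIntegrand (k : ℕ) : Measurable (pathLossIntegrand prm k) := by
  unfold pathLossIntegrand; fun_prop

lemma integrableOn_pathLossIntegrand_succ (k : ℕ) :
    IntegrableOn (pathLossIntegrand prm (k + 1)) (Ioi 0) :=
  Integrable.mono' (integrableOn_radialBlockProb prm)
    (measurable_pathLossIntegrand prm _).aestronglyMeasurable
    ((ae_restrict_mem measurableSet_Ioi).mono fun _ hv =>
      abs_pathLossIntegrand_succ_le prm k (le_of_lt hv))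

lemma integrable_activity_pow (k : ℕ) : Integrable (fun m => activity prm m ^ k) law := by
  refine Integrable.of_bound (C := 1) ((measurable_activity prm).pow_const k).aestronglyMeasurable
    (ae_of_all _ fun m => ?_)
  have h1 := activity_pos prm m
  rw [Real.norm_of_nonneg (by positivity)]
  exact pow_le_one₀ h1.le ((activity_le prm m).trans prm.p_lt_one.le)

/-- The exponent is the sum of the binomial series: the series of the integrand is dominated by
`∑ |binom(jω, k)| p ^ k`, times the integrable function `radialBlockProb`, so it can be integrated
term by term. -/
lemma hasSum_radialExponent (w : ℝ) :
    HasSum (fun k : ℕ => Ring.choose (Complex.I * (w : ℂ)) (k + 1) *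
      ((∫ v in Ioi (0 : ℝ), pathLossIntegrand prm (k + 1) v : ℝ) : ℂ) *
      ((∫ m, activity prm m ^ (k + 1) ∂law : ℝ) : ℂ)) (radialExponent prm law w) := by
  have hp0 := prm.p_pos; have hp1 := prm.p_lt_one
  set ν := (volume.restrict (Ioi (0 : ℝ))).prod law with hν
  set F : ℕ → ℝ × ℝ → ℂ := fun k q => Ring.choose (Complex.I * (w : ℂ)) (k + 1) *
    ((pathLossIntegrand prm (k + 1) q.1 : ℂ) * ((activity prm q.2 ^ (k + 1) : ℝ) : ℂ)) with hF
  have hprod : ∀ k, Integrable (fun q : ℝ × ℝ =>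
      (pathLossIntegrand prm (k + 1) q.1 : ℂ) * ((activity prm q.2 ^ (k + 1) : ℝ) : ℂ)) ν :=
    fun k => (integrableOn_pathLossIntegrand_succ prm k).ofReal.mul_prod
      (integrable_activity_pow prm law (k + 1)).ofReal
  have hFi : ∀ k, Integrable (F k) ν := fun k => (hprod k).const_mul _
  have hv : ∀ᵐ q ∂ν, 0 < q.1 :=
    Measure.quasiMeasurePreserving_fst.ae (ae_restrict_mem measurableSet_Ioi)
  have hDi : Integrable (fun q : ℝ × ℝ => radialBlockProb prm q.1) ν :=
    (integrableOn_radialBlockProb prm).comp_fst law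
  have hbound : ∀ k, ∀ᵐ q ∂ν, ‖F k q‖
      ≤ ‖Ring.choose (Complex.I * (w : ℂ)) (k + 1)‖ * prm.p ^ (k + 1)
        * radialBlockProb prm q.1 := by
    intro k
    refine hv.mono fun q hq => ?_
    have h1 := activity_pos prm q.2
    rw [hF, norm_mul, norm_mul, Complex.norm_real, Complex.norm_real, Real.norm_eq_abs,
      Real.norm_of_nonneg (pow_nonneg h1.le _), mul_assoc, mul_comm (prm.p ^ (k + 1))]
    have h2 := abs_pathLossIntegrand_succ_le prm k hq.le
    have h3 := activity_le prm q.2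
    have h4 := (radialBlockProb_pos prm hq.le).le
    gcongr
  have hsum : Summable fun k => ∫ q, ‖F k q‖ ∂ν := by
    have hs := (summable_nat_add_iff 1).2
      (summable_norm_choose_mul_pow (Complex.I * w) hp0.le hp1)
    refine Summable.of_nonneg_of_le (fun k => integral_nonneg fun q => norm_nonneg _)
      (fun k => ?_) (hs.mul_right (∫ q, radialBlockProb prm q.1 ∂ν))
    rw [← integral_const_mul]
    exact integral_mono_ae (hFi k).norm (hDi.const_mul _) (hbound k)
  have key := hasSum_integral_of_summable_integral_norm hFi hsum
  have hval : ∫ q, ∑' k, F k q ∂ν = radialExponent prm law w := by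
    have h1 : ∀ᵐ q ∂ν, ∑' k, F k q = 1 - Complex.exp (Complex.I *
        (w * Real.log (1 - activity prm q.2 * radialBlockProb prm q.1) : ℝ)) := by
      refine hv.mono fun q hq => ?_
      obtain ⟨h1, -, h3⟩ := activity_mul_mem prm q.2 (radialBlockProb_pos prm hq.le).le
        (radialBlockProb_le_one prm hq.le)
      rw [← (hasSum_choose_mul_pow_of_lt_one w h1 h3).tsum_eq]
      refine tsum_congr fun k => ?_
      simp only [hF, pathLossIntegrand_eq]
      push_cast
      ring
    have hint : Integrable (fun q : ℝ × ℝ => 1 - Complex.exp (Complex.I *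
        (w * Real.log (1 - activity prm q.2 * radialBlockProb prm q.1) : ℝ))) ν := by
      refine Integrable.mono' (hDi.const_mul (|w| * (prm.p / (1 - prm.p)))) ?_ ?_
      · refine (measurable_const.sub ?_).aestronglyMeasurable
        exact (measurable_exp_I_mul_log prm w).comp
          (((measurable_radialBlockProb prm).comp measurable_fst).prodMk measurable_snd)
      · exact hv.mono fun q hq => norm_one_sub_exp_I_mul_log_le prm w q.2
          (radialBlockProb_pos prm hq.le).le (radialBlockProb_le_one prm hq.le)
    rw [integral_congr_ae h1, integral_prod _ hint]
    rfl
  rw [hval] at key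
  refine key.congr_fun fun k => ?_
  simp only [hF]
  rw [integral_const_mul, integral_prod_mul
    (fun v => (pathLossIntegrand prm (k + 1) v : ℂ))
    (fun m => ((activity prm m ^ (k + 1) : ℝ) : ℂ)),
    mul_assoc]
  congr 2
  · exact integral_ofReal.symm
  · exact integral_ofReal.symm

/-! ### Decay of the characteristic function -/

lemma re_markDefect (w d : ℝ) :
    (markDefect prm law w d).re
      = ∫ m, (1 - Real.cos (w * Real.log (1 - activity prm m * d))) ∂law := by
  unfold markDefect
  have hint := (integrable_const (μ := law) (1 : ℂ)).sub (integrable_exp_I_mul_log prm law w d)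
  refine Eq.trans (integral_re (𝕜 := ℂ) hint).symm (integral_congr_ae (ae_of_all _ fun m => ?_))
  simp only [RCLike.re_eq_complex_re, Pi.sub_apply, Complex.sub_re, Complex.one_re]
  rw [mul_comm Complex.I, Complex.exp_ofReal_mul_I_re]

lemma re_markDefect_nonneg (w d : ℝ) : 0 ≤ (markDefect prm law w d).re := by
  rw [re_markDefect]
  exact integral_nonneg fun m => sub_nonneg.2 (Real.cos_le_one _)

/-- If the phase `ω log (1 - a d)` stays between `c` and `π` in modulus for every mark, then
`1 - cos` of it is at least `2 c² / π²`. -/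
lemma le_re_markDefect {w d c : ℝ} (hd0 : 0 ≤ d) (hd1 : d ≤ 1) (hw : 0 ≤ w) (hc : 0 ≤ c)
    (hlo : c ≤ w * (prm.p * prm.xi * d)) (hhi : w * (prm.p / (1 - prm.p) * d) ≤ Real.pi) :
    2 / Real.pi ^ 2 * c ^ 2 ≤ (markDefect prm law w d).re := by
  rw [re_markDefect]
  have hpt : ∀ m, 2 / Real.pi ^ 2 * c ^ 2
      ≤ 1 - Real.cos (w * Real.log (1 - activity prm m * d)) := by
    intro m
    have h1 := abs_log_one_sub_activity_mul_le prm m hd0 hd1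
    have h2 := le_abs_log_one_sub_activity_mul prm m hd0 hd1
    set y := w * Real.log (1 - activity prm m * d) with hy
    have hyabs : |y| = w * |Real.log (1 - activity prm m * d)| := by
      rw [hy, abs_mul, abs_of_nonneg hw]
    have h3 : |y| ≤ Real.pi := by
      rw [hyabs]; exact (mul_le_mul_of_nonneg_left h1 hw).trans hhi
    have h4 : c ≤ |y| := by
      rw [hyabs]; exact hlo.trans (mul_le_mul_of_nonneg_left h2 hw)
    have h5 := Real.cos_le_one_sub_mul_cos_sq h3
    have h6 : c ^ 2 ≤ y ^ 2 := by rw [← sq_abs y]; gcongr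
    have h7 : 2 / Real.pi ^ 2 * c ^ 2 ≤ 2 / Real.pi ^ 2 * y ^ 2 := by gcongr
    linarith
  have hint : Integrable (fun m => 1 - Real.cos (w * Real.log (1 - activity prm m * d))) law := by
    have := measurable_activity prm
    refine (integrable_const 1).sub (Integrable.of_bound (C := 1) ?_
      (ae_of_all _ fun m => Real.abs_cos_le_one _))
    exact (Real.measurable_cos.comp ((Real.measurable_log.comp (measurable_const.sub
      (this.mul_const d))).const_mul w)).aestronglyMeasurable
  have := integral_mono (integrable_const (μ := law) (2 / Real.pi ^ 2 * c ^ 2)) hint hpt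
  simpa using this

/-- The real part of the exponent grows like `ω ^ δ`: interferers at normalized distance
`v ^ (α / 2) ≈ ω` each contribute a term bounded below, and their number is of order `ω ^ δ`. -/
lemma exists_le_re_radialExponent :
    ∃ c : ℝ, 0 < c ∧ ∀ w : ℝ, 1 ≤ w → c * w ^ prm.delta ≤ (radialExponent prm law w).re := by
  have hp0 := prm.p_pos; have hp1 := prm.p_lt_one; have hξ := prm.xi_pos
  have hα := prm.two_lt_alpha
  have hδ : 0 < prm.delta := by unfold NetworkParams.delta; positivity
  -- on `K ω < v ^ (α / 2) ≤ 2 K ω` the phases are at most `π`, by the choice of `K`,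
  -- and at least `c₀`
  set K : ℝ := prm.p / ((1 - prm.p) * Real.pi) with hK
  have hKpos : 0 < K := by
    have := Real.pi_pos
    have : 0 < 1 - prm.p := by linarith
    positivity
  set c₀ : ℝ := prm.p * prm.xi / (1 + 2 * K) with hc₀
  have hc₀pos : 0 < c₀ := by positivity
  have hlen : 0 < (2 * K) ^ prm.delta - K ^ prm.delta := by
    have := Real.rpow_lt_rpow hKpos.le (by linarith : K < 2 * K) hδ
    linarith
  refine ⟨2 / Real.pi ^ 2 * c₀ ^ 2 * ((2 * K) ^ prm.delta - K ^ prm.delta), by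
    have := Real.pi_pos; positivity, fun w hw => ?_⟩
  have hw0 : 0 < w := by linarith
  set S : Set ℝ := Ioc ((K * w) ^ prm.delta) ((2 * K * w) ^ prm.delta) with hS
  have hSsub : S ⊆ Ioi 0 := fun v hv => lt_of_le_of_lt (by positivity) hv.1
  have hre : (radialExponent prm law w).re
      = ∫ v in Ioi (0 : ℝ), (markDefect prm law w (radialBlockProb prm v)).re := by
    have := integral_re (𝕜 := ℂ) (integrableOn_markDefect_radialBlockProb prm law w)
    exact this.symm
  have hpow : ∀ z : ℝ, 0 ≤ z → (z ^ prm.delta) ^ (prm.alpha / 2) = z := by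
    intro z hz
    have : prm.delta * (prm.alpha / 2) = 1 := by
      unfold NetworkParams.delta
      have : prm.alpha ≠ 0 := by linarith
      field_simp
    rw [← Real.rpow_mul hz, this, Real.rpow_one]
  have hpt : ∀ v ∈ S, 2 / Real.pi ^ 2 * c₀ ^ 2
      ≤ (markDefect prm law w (radialBlockProb prm v)).re := by
    intro v hv
    have hv0 : 0 < v := hSsub hv
    have hα2 : 0 < prm.alpha / 2 := by linarith
    have h1 : K * w < v ^ (prm.alpha / 2) := by
      rw [← hpow (K * w) (by positivity)]
      exact Real.rpow_lt_rpow (by positivity) hv.1 hα2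
    have h2 : v ^ (prm.alpha / 2) ≤ 2 * K * w := by
      rw [← hpow (2 * K * w) (by positivity)]
      exact Real.rpow_le_rpow hv0.le hv.2 hα2.le
    refine le_re_markDefect prm law (radialBlockProb_pos prm hv0.le).le
      (radialBlockProb_le_one prm hv0.le) hw0.le hc₀pos.le ?_ ?_
    · rw [hc₀]
      unfold radialBlockProb
      rw [div_le_iff₀ (by positivity)]
      have h3 : 0 < 1 + v ^ (prm.alpha / 2) := by positivity
      rw [show w * (prm.p * prm.xi * (1 / (1 + v ^ (prm.alpha / 2)))) * (1 + 2 * K)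
        = prm.p * prm.xi * (w * (1 + 2 * K)) / (1 + v ^ (prm.alpha / 2)) by ring,
        le_div_iff₀ h3]
      have : 1 + v ^ (prm.alpha / 2) ≤ w * (1 + 2 * K) := by nlinarith
      gcongr
    · unfold radialBlockProb
      have h3 : 0 < 1 + v ^ (prm.alpha / 2) := by positivity
      have h4 : 0 < 1 - prm.p := by linarith
      rw [show w * (prm.p / (1 - prm.p) * (1 / (1 + v ^ (prm.alpha / 2))))
        = w * (prm.p / (1 - prm.p)) / (1 + v ^ (prm.alpha / 2)) by ring, div_le_iff₀ h3]
      have h5 : prm.p / (1 - prm.p) = Real.pi * K := by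
        rw [hK]
        have := Real.pi_pos.ne'
        field_simp
      rw [h5]
      have := Real.pi_pos
      nlinarith
  rw [hre]
  have hint : IntegrableOn (fun v => (markDefect prm law w (radialBlockProb prm v)).re) (Ioi 0) :=
    (integrableOn_markDefect_radialBlockProb prm law w).re
  calc 2 / Real.pi ^ 2 * c₀ ^ 2 * ((2 * K) ^ prm.delta - K ^ prm.delta) * w ^ prm.delta
      = ∫ v in S, 2 / Real.pi ^ 2 * c₀ ^ 2 := by
        rw [setIntegral_const, hS, Real.volume_real_Ioc_of_le
          (Real.rpow_le_rpow (by positivity) (by nlinarith) hδ.le),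
          Real.mul_rpow (by positivity) hw0.le, Real.mul_rpow (by positivity) hw0.le, smul_eq_mul]
        ring
    _ ≤ ∫ v in S, (markDefect prm law w (radialBlockProb prm v)).re := by
        refine setIntegral_mono_on ?_ (hint.mono_set hSsub) measurableSet_Ioc hpt
        exact integrableOn_const (by simp [hS])
    _ ≤ ∫ v in Ioi (0 : ℝ), (markDefect prm law w (radialBlockProb prm v)).re := by
        refine setIntegral_mono_set hint (ae_of_all _ fun v => re_markDefect_nonneg prm law w _)
          (LE.le.eventuallyLE hSsub)

lemma re_radialExponent_nonneg (w : ℝ) : 0 ≤ (radialExponent prm law w).re := by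
  have := integral_re (𝕜 := ℂ) (integrableOn_markDefect_radialBlockProb prm law w)
  refine le_of_le_of_eq ?_ this
  exact integral_nonneg fun v => re_markDefect_nonneg prm law w _

/-- A function of modulus `exp (-C Re ψ(ω))`, with `ψ` the exponent, is integrable. -/
lemma integrableOn_of_norm_le_exp_radialExponent {φ : ℝ → ℂ} (hφ : Measurable φ) {C : ℝ}
    (hC : 0 < C) (h : ∀ w, ‖φ w‖ ≤ Real.exp (-(C * (radialExponent prm law w).re))) :
    IntegrableOn φ (Ioi 0) := by
  have hα := prm.two_lt_alpha
  have hδ : 0 < prm.delta := by unfold NetworkParams.delta; positivity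
  obtain ⟨c, hc, hle⟩ := exists_le_re_radialExponent prm law
  rw [← Ioc_union_Ioi_eq_Ioi (zero_le_one' ℝ)]
  refine IntegrableOn.union ?_ ?_
  · refine Measure.integrableOn_of_bounded (M := 1) (by simp) hφ.aestronglyMeasurable
      (ae_of_all _ fun w => (h w).trans ?_)
    rw [Real.exp_le_one_iff]
    have := mul_nonneg hC.le (re_radialExponent_nonneg prm law w)
    linarith
  · have hdom := integrableOn_rpow_mul_exp_neg_mul_rpow (p := prm.delta) (s := 0) (b := C * c)
      (by norm_num) hδ (by positivity)
    refine Integrable.mono' (hdom.mono_set (Ioi_subset_Ioi zero_le_one)) hφ.aestronglyMeasurable ?_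
    refine (ae_restrict_mem measurableSet_Ioi).mono fun w (hw : 1 < w) => (h w).trans ?_
    rw [Real.rpow_zero, one_mul, Real.exp_le_exp, neg_mul, neg_le_neg_iff, mul_assoc]
    exact mul_le_mul_of_nonneg_left (hle w hw.le) hC.le

end AoINetwork

namespace AoINetwork

/-! ### The law of the slot inputs -/

/-- The inputs of one node in one slot: arrival, channel access, uniform variable, power gain. -/
abbrev SlotInput : Type := Bool × Bool × ℝ × ℝ

/-- The inputs of all nodes in all slots. -/
abbrev InputSpace : Type := ℕ × ℕ → SlotInput

/-- The indicator of `true` as a real number. -/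
def boolInd (b : Bool) : ℝ := if b then 1 else 0

@[simp] lemma boolInd_true : boolInd true = 1 := rfl
@[simp] lemma boolInd_false : boolInd false = 0 := rfl

lemma boolInd_mem (b : Bool) : 0 ≤ boolInd b ∧ boolInd b ≤ 1 := by cases b <;> simp

lemma boolInd_and (a b : Bool) : boolInd (a && b) = boolInd a * boolInd b := by
  cases a <;> simp

lemma boolInd_or (a b : Bool) : boolInd (a || b) = boolInd a + (1 - boolInd a) * boolInd b := by
  cases a <;> simp

lemma boolInd_not (a : Bool) : boolInd (!a) = 1 - boolInd a := by
  cases a <;> simp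

lemma measurable_boolInd : Measurable boolInd := measurable_from_top

lemma isProbabilityMeasure_coinLaw {q : ℝ} (h0 : 0 ≤ q) (h1 : q ≤ 1) :
    IsProbabilityMeasure (coinLaw q) := by
  refine ⟨?_⟩
  simp only [coinLaw, Measure.add_apply, Measure.smul_apply, measure_univ, smul_eq_mul, mul_one]
  rw [← ENNReal.ofReal_add h0 (by linarith)]
  simp

lemma integral_coinLaw {q : ℝ} (h0 : 0 ≤ q) (h1 : q ≤ 1) (f : Bool → ℝ) :
    ∫ b, f b ∂(coinLaw q) = q * f true + (1 - q) * f false := by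
  unfold coinLaw
  rw [integral_add_measure ((integrable_dirac (by finiteness)).smul_measure ENNReal.ofReal_ne_top)
    ((integrable_dirac (by finiteness)).smul_measure ENNReal.ofReal_ne_top), integral_smul_measure,
    integral_smul_measure, integral_dirac, integral_dirac, ENNReal.toReal_ofReal h0,
    ENNReal.toReal_ofReal (by linarith), smul_eq_mul, smul_eq_mul]

instance isProbabilityMeasure_expMeasure_one : IsProbabilityMeasure (expMeasure 1) :=
  isProbabilityMeasure_expMeasure one_pos

instance isProbabilityMeasure_volume_cond_Icc :
    IsProbabilityMeasure ((volume : Measure ℝ)[|Icc (0 : ℝ) 1]) :=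
  cond_isProbabilityMeasure_of_finite (by simp) (by simp)

variable (prm : NetworkParams)

instance isProbabilityMeasure_coinLaw_xi : IsProbabilityMeasure (coinLaw prm.xi) :=
  isProbabilityMeasure_coinLaw prm.xi_pos.le prm.xi_le_one

instance isProbabilityMeasure_coinLaw_p : IsProbabilityMeasure (coinLaw prm.p) :=
  isProbabilityMeasure_coinLaw prm.p_pos.le prm.p_lt_one.le

instance isProbabilityMeasure_slotLaw : IsProbabilityMeasure (slotLaw prm) := by
  unfold slotLaw; infer_instance

lemma integral_slotLaw_mul (f g : Bool → ℝ) (k l : ℝ → ℝ) :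
    ∫ y, f y.1 * (g y.2.1 * (k y.2.2.1 * l y.2.2.2)) ∂(slotLaw prm)
      = (∫ b, f b ∂(coinLaw prm.xi)) * ((∫ b, g b ∂(coinLaw prm.p)) *
        ((∫ u, k u ∂(volume : Measure ℝ)[|Icc (0 : ℝ) 1]) * ∫ h, l h ∂(expMeasure 1))) := by
  unfold slotLaw
  rw [integral_prod_mul f (fun q : Bool × ℝ × ℝ => g q.1 * (k q.2.1 * l q.2.2)),
    integral_prod_mul g (fun q : ℝ × ℝ => k q.1 * l q.2), integral_prod_mul k l]

lemma expMeasure_one_Ioi {y : ℝ} (hy : 0 ≤ y) :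
    expMeasure 1 (Ioi y) = ENNReal.ofReal (Real.exp (-y)) := by
  have h1 := cdf_expMeasure_eq one_pos y
  rw [if_pos hy, cdf_eq_real, one_mul] at h1
  have h2 : (expMeasure 1).real (Ioi y) = Real.exp (-y) := by
    rw [← compl_Iic, probReal_compl_eq_one_sub measurableSet_Iic, h1]; ring
  rw [← h2, Measure.real, ENNReal.ofReal_toReal (by finiteness)]

/-- Laplace transform of the unit exponential law. -/
lemma integral_exp_neg_mul_expMeasure_one {s : ℝ} (hs : 0 ≤ s) :
    ∫ h, Real.exp (-(s * max h 0)) ∂(expMeasure 1) = 1 / (1 + s) := by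
  have hm : Measurable (gammaPDF 1 1) := (measurable_gammaPDFReal 1 1).ennreal_ofReal
  unfold expMeasure gammaMeasure
  rw [integral_withDensity_eq_integral_toReal_smul hm (ae_of_all _ fun x => ENNReal.ofReal_lt_top)]
  have h1 : ∀ x : ℝ, (gammaPDF 1 1 x).toReal • Real.exp (-(s * max x 0))
      = (Ici (0 : ℝ)).indicator (fun x => Real.exp (-((1 + s) * x))) x := by
    intro x
    have h2 : gammaPDF 1 1 x = exponentialPDF 1 x := rfl
    by_cases hx : 0 ≤ x
    · rw [h2, exponentialPDF_of_nonneg hx, indicator_of_mem (mem_Ici.2 hx), max_eq_left hx,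
        ENNReal.toReal_ofReal (by positivity), smul_eq_mul, one_mul, ← Real.exp_add]
      ring_nf
    · rw [h2, exponentialPDF_of_neg (not_le.1 hx), indicator_of_notMem (by simpa using hx)]
      simp
  simp_rw [h1]
  rw [integral_indicator measurableSet_Ici, integral_Ici_eq_integral_Ioi]
  have h2 := integral_exp_neg_mul_mul_cos (ε := 1 + s) (by linarith) 0
  simp only [mul_zero, Real.cos_zero, mul_one] at h2
  rw [h2]
  have : (1 + s) ≠ 0 := by linarith
  field_simp
  simp

/-- The probability that a uniform variable on `[0, 1]` is below `m` is `m` clamped to `[0, 1]`. -/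
lemma integral_boolInd_lt (m : ℝ) :
    ∫ u, boolInd (decide (u < m)) ∂((volume : Measure ℝ)[|Icc (0 : ℝ) 1]) = max 0 (min m 1) := by
  have h1 : ∀ u : ℝ, boolInd (decide (u < m)) = (Iio m).indicator 1 u := by
    intro u
    by_cases h : u < m <;> simp [h]
  simp_rw [h1]
  rw [integral_indicator_one measurableSet_Iio, Measure.real, cond_apply measurableSet_Icc]
  simp only [Real.volume_Icc, sub_zero, ENNReal.ofReal_one, inv_one, one_mul]
  have h2 : volume (Icc (0 : ℝ) 1 ∩ Iio m) = volume (Icc (0 : ℝ) (min m 1)) := by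
    apply le_antisymm
    · exact measure_mono fun u hu => ⟨hu.1.1, le_min (le_of_lt hu.2) hu.1.2⟩
    · rw [← Ico_ae_eq_Icc.measure_eq]
      exact measure_mono fun u hu => ⟨⟨hu.1, (hu.2.trans_le (min_le_right _ _)).le⟩,
        hu.2.trans_le (min_le_left _ _)⟩
  rw [h2, Real.volume_Icc, sub_zero, ENNReal.toReal_ofReal']
  exact max_comm _ _

/-! ### Buffers as functions of the inputs -/

/-- In a slot with input `y`, a node with success probability `m` delivers a stored packet. -/
noncomputable def delivers (m : ℝ) (y : SlotInput) : Bool := y.2.1 && decide (y.2.2.1 < m)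

/-- Whether the buffer of a node with success probability `m` is non-empty in slot `t`, as a
function of the inputs `y` of the node. -/
noncomputable def nodeBuffer (m : ℝ) (y : ℕ → SlotInput) (t : ℕ) : Bool :=
  buffer (fun s => (y s).1) (fun s => delivers m (y s)) t

/-- Whether a packet is left over at the end of slot `t - 1`; a function of the inputs strictly
before slot `t`. -/
noncomputable def leftover (m : ℝ) (y : ℕ → SlotInput) : ℕ → Bool
  | 0 => false
  | t + 1 => nodeBuffer m y t && !delivers m (y t)

lemma nodeBuffer_eq (m : ℝ) (y : ℕ → SlotInput) (t : ℕ) :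
    nodeBuffer m y t = ((y t).1 || leftover m y t) := by
  cases t with
  | zero => simp [nodeBuffer, buffer, leftover]
  | succ t => rfl

lemma measurable_buffer {α : Type*} [MeasurableSpace α] {A S : ℕ → α → Bool} (t : ℕ)
    (hA : ∀ s ≤ t, Measurable (A s)) (hS : ∀ s < t, Measurable (S s)) :
    Measurable fun a => buffer (fun s => A s a) (fun s => S s a) t := by
  induction t with
  | zero => exact hA 0 le_rfl
  | succ t ih =>
    have h1 := ih (fun s hs => hA s (by omega)) fun s hs => hS s (by omega)
    have h2 := hA (t + 1) le_rfl
    have h3 := hS t (by omega)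
    exact (Measurable.of_discrete (f := fun q : Bool × Bool × Bool => q.1 || (q.2.1 && !q.2.2))).comp
      (h2.prodMk (h1.prodMk h3))

lemma measurable_delivers {α : Type*} [MeasurableSpace α] {m : α → ℝ} {y : α → SlotInput}
    (hm : Measurable m) (hy : Measurable y) : Measurable fun a => delivers (m a) (y a) := by
  have h1 : Measurable fun a => decide ((y a).2.2.1 < m a) :=
    measurable_to_bool (by
      have : MeasurableSet {a | (y a).2.2.1 < m a} :=
        measurableSet_lt (measurable_fst.comp (measurable_snd.comp (measurable_snd.comp hy))) hm
      convert! this using 1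
      ext a; simp)
  exact (Measurable.of_discrete (f := fun q : Bool × Bool => q.1 && q.2)).comp
    ((measurable_fst.comp (measurable_snd.comp hy)).prodMk h1)

lemma measurable_nodeBuffer {α : Type*} [MeasurableSpace α] {m : α → ℝ} {y : ℕ → α → SlotInput}
    (t : ℕ) (hm : Measurable m) (hy : ∀ s ≤ t, Measurable (y s)) :
    Measurable fun a => nodeBuffer (m a) (fun s => y s a) t :=
  measurable_buffer t (fun s hs => measurable_fst.comp (hy s hs))
    fun s hs => measurable_delivers hm (hy s hs.le)

lemma measurable_leftover {α : Type*} [MeasurableSpace α] {m : α → ℝ} {y : ℕ → α → SlotInput}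
    (t : ℕ) (hm : Measurable m) (hy : ∀ s < t, Measurable (y s)) :
    Measurable fun a => leftover (m a) (fun s => y s a) t := by
  cases t with
  | zero => exact measurable_const
  | succ t =>
    exact (Measurable.of_discrete (f := fun q : Bool × Bool => q.1 && !q.2)).comp
      ((measurable_nodeBuffer t hm fun s hs => hy s (by omega)).prodMk
        (measurable_delivers hm (hy t (by omega))))

/-! ### Independence of disjoint sets of inputs -/

/-- The σ-algebra generated by the inputs with index in `S`. -/
abbrev inputSigma (S : Set (ℕ × ℕ)) : MeasurableSpace InputSpace :=
  ⨆ i ∈ S, MeasurableSpace.comap (fun z : InputSpace => z i) inferInstance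

lemma inputSigma_le (S : Set (ℕ × ℕ)) : inputSigma S ≤ MeasurableSpace.pi :=
  iSup₂_le fun i _ => (measurable_pi_apply i).comap_le

lemma measurable_eval_inputSigma {S : Set (ℕ × ℕ)} {i : ℕ × ℕ} (hi : i ∈ S) :
    Measurable[inputSigma S] (fun z : InputSpace => z i) :=
  (comap_measurable _).mono (le_iSup₂ (f := fun i (_ : i ∈ S) =>
    MeasurableSpace.comap (fun z : InputSpace => z i) inferInstance) i hi) le_rfl

/-- The law of all inputs. -/
noncomputable abbrev inputLaw : Measure InputSpace :=
  Measure.infinitePi (fun _ : ℕ × ℕ => slotLaw prm)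

lemma indep_inputSigma {S T : Set (ℕ × ℕ)} (h : Disjoint S T) :
    Indep (inputSigma S) (inputSigma T) (inputLaw prm) :=
  indep_iSup_of_disjoint (fun i => (measurable_pi_apply i).comap_le)
    (iIndepFun_infinitePi (P := fun _ : ℕ × ℕ => slotLaw prm) (X := fun _ y => y)
      fun _ => measurable_id).iIndep h

lemma indepFun_of_inputSigma {β γ : Type*} [MeasurableSpace β] [MeasurableSpace γ]
    {S T : Set (ℕ × ℕ)} (h : Disjoint S T) {f : InputSpace → β} {g : InputSpace → γ}
    (hf : Measurable[inputSigma S] f) (hg : Measurable[inputSigma T] g) :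
    IndepFun f g (inputLaw prm) := by
  rw [IndepFun_iff_Indep]
  exact indep_of_indep_of_le (indep_inputSigma prm h) hf.comap_le hg.comap_le

lemma integral_mul_of_inputSigma {S T : Set (ℕ × ℕ)} (h : Disjoint S T) {f g : InputSpace → ℝ}
    (hf : Measurable[inputSigma S] f) (hg : Measurable[inputSigma T] g) :
    ∫ z, f z * g z ∂(inputLaw prm) = (∫ z, f z ∂(inputLaw prm)) * ∫ z, g z ∂(inputLaw prm) :=
  (indepFun_of_inputSigma prm h hf hg).integral_fun_mul_eq_mul_integral
    (hf.mono (inputSigma_le S) le_rfl).aestronglyMeasurable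
    (hg.mono (inputSigma_le T) le_rfl).aestronglyMeasurable

lemma integral_eval_inputLaw (i : ℕ × ℕ) {f : SlotInput → ℝ} (hf : Measurable f) :
    ∫ z, f (z i) ∂(inputLaw prm) = ∫ y, f y ∂(slotLaw prm) := by
  rw [← Measure.infinitePi_map_eval (fun _ : ℕ × ℕ => slotLaw prm) i,
    integral_map (measurable_pi_apply i).aemeasurable hf.aestronglyMeasurable]

/-! ### Transient buffer occupation -/

/-- The probability that the buffer of a node with success probability `m` is non-empty in slot
`t`, by its recursion over time. The success probability is clamped to `[0, 1]`, since it enters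
through a comparison with a uniform variable. -/
noncomputable def bufferProb (m : ℝ) : ℕ → ℝ
  | 0 => prm.xi
  | t + 1 => prm.xi + (1 - prm.xi) * (bufferProb m t * (1 - prm.p * max 0 (min m 1)))

lemma clamp_mem (m : ℝ) : 0 ≤ max 0 (min m 1) ∧ max 0 (min m 1) ≤ 1 :=
  ⟨le_max_left _ _, max_le zero_le_one (min_le_right _ _)⟩

lemma bufferProb_mem (m : ℝ) (t : ℕ) : 0 ≤ bufferProb prm m t ∧ bufferProb prm m t ≤ 1 := by
  have h1 := prm.xi_pos; have h2 := prm.xi_le_one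
  have h3 := prm.p_pos; have h4 := prm.p_lt_one
  obtain ⟨h5, h6⟩ := clamp_mem m
  induction t with
  | zero => exact ⟨h1.le, h2⟩
  | succ t ih =>
    have h7 : 0 ≤ 1 - prm.p * max 0 (min m 1) := by nlinarith
    have h8 : 1 - prm.p * max 0 (min m 1) ≤ 1 := by nlinarith [mul_nonneg h3.le h5]
    have h9 := mul_nonneg ih.1 h7
    have h10 := mul_le_one₀ ih.2 h7 h8
    refine ⟨?_, ?_⟩
    · unfold bufferProb
      nlinarith [mul_nonneg (sub_nonneg.2 h2) h9]
    · unfold bufferProb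
      nlinarith [mul_le_mul_of_nonneg_left h10 (sub_nonneg.2 h2)]

/-- The occupation probabilities converge geometrically, with ratio `(1 - ξ) (1 - p m) < 1`. -/
lemma tendsto_bufferProb (m : ℝ) :
    Tendsto (fun t => prm.p * bufferProb prm m t) atTop (𝓝 (activity prm m)) := by
  have h1 := prm.xi_pos; have h2 := prm.xi_le_one
  have h3 := prm.p_pos; have h4 := prm.p_lt_one
  obtain ⟨h5, h6⟩ := clamp_mem m
  set c := max 0 (min m 1) with hc
  set κ := (1 - prm.xi) * (1 - prm.p * c) with hκ
  have hD : 0 < prm.xi + (1 - prm.xi) * prm.p * c :=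
    h1.trans_le (activity_denom_mem prm m).1
  have h7 : 0 ≤ 1 - prm.p * c := by nlinarith
  have hκ0 : 0 ≤ κ := mul_nonneg (by linarith) h7
  have hκ1 : κ < 1 := by
    have : κ = 1 - (prm.xi + (1 - prm.xi) * prm.p * c) := by rw [hκ]; ring
    linarith
  set b := prm.xi / (prm.xi + (1 - prm.xi) * prm.p * c) with hb
  have hfix : prm.xi + κ * b = b := by
    rw [hb, hκ]; field_simp; ring
  have hform : ∀ t, bufferProb prm m t = b + κ ^ t * (prm.xi - b) := by
    intro t
    induction t with
    | zero => simp [bufferProb]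
    | succ t ih =>
      have : bufferProb prm m (t + 1) = prm.xi + κ * bufferProb prm m t := by
        rw [hκ, bufferProb]; ring
      rw [this, ih, pow_succ]
      linear_combination hfix
  have hlim : Tendsto (fun t => prm.p * bufferProb prm m t) atTop
      (𝓝 (prm.p * (b + 0 * (prm.xi - b)))) := by
    simp_rw [hform]
    exact (((tendsto_pow_atTop_nhds_zero_of_lt_one hκ0 hκ1).mul_const _).const_add _).const_mul _
  convert hlim using 2
  rw [activity, hb]
  ring

lemma measurable_boolInd_leftover (m : ℝ) (j t : ℕ) :
    Measurable[inputSigma ({j} ×ˢ Iio t)] fun z : InputSpace =>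
      boolInd (leftover m (fun s => z (j, s)) t) :=
  measurable_boolInd.comp (@measurable_leftover InputSpace (inputSigma _) (fun _ => m)
    (fun s z => z (j, s)) t measurable_const
    fun s hs => measurable_eval_inputSigma (by simpa using hs))

lemma disjoint_past_present (j t : ℕ) :
    Disjoint (({j} : Set ℕ) ×ˢ Iio t) {((j, t) : ℕ × ℕ)} := by
  rw [disjoint_singleton_right]
  simp

lemma integrable_of_mem_Icc {α : Type*} [MeasurableSpace α] {μ : Measure α} [IsFiniteMeasure μ]
    {f : α → ℝ} (hf : Measurable f) (h : ∀ a, 0 ≤ f a ∧ f a ≤ 1) : Integrable f μ :=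
  Integrable.of_bound (C := 1) hf.aestronglyMeasurable
    (ae_of_all _ fun a => by rw [Real.norm_of_nonneg (h a).1]; exact (h a).2)

/-- The buffer in slot `t` and a bounded function `g` of the other inputs of slot `t`: only the
arrival of the slot and the independent leftover enter. -/
lemma integral_boolInd_nodeBuffer_mul (m : ℝ) (j t : ℕ) {g : Bool → ℝ × ℝ → ℝ}
    (hg : Measurable (Function.uncurry g)) (hg1 : ∀ b q, 0 ≤ g b q ∧ g b q ≤ 1) :
    ∫ z, boolInd (nodeBuffer m (fun s => z (j, s)) t) * g (z (j, t)).2.1 (z (j, t)).2.2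
        ∂(inputLaw prm)
      = (prm.xi + (1 - prm.xi) *
          ∫ z, boolInd (leftover m (fun s => z (j, s)) t) ∂(inputLaw prm))
        * ∫ y, g y.2.1 y.2.2 ∂(slotLaw prm) := by
  have hgm : Measurable fun y : SlotInput => g y.2.1 y.2.2 :=
    hg.comp measurable_snd
  have hAm : Measurable fun y : SlotInput => boolInd y.1 := measurable_boolInd.comp measurable_fst
  have hfac : ∀ f : Bool → ℝ, ∫ y : SlotInput, f y.1 * g y.2.1 y.2.2 ∂(slotLaw prm)
      = (∫ b, f b ∂(coinLaw prm.xi)) * ∫ y, g y.2.1 y.2.2 ∂(slotLaw prm) := by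
    intro f
    have h1 := integral_prod_mul (μ := coinLaw prm.xi) (ν := (coinLaw prm.p).prod
      (((volume : Measure ℝ)[|Icc (0 : ℝ) 1]).prod (expMeasure 1))) f (Function.uncurry g)
    have h2 := integral_prod_mul (μ := coinLaw prm.xi) (ν := (coinLaw prm.p).prod
      (((volume : Measure ℝ)[|Icc (0 : ℝ) 1]).prod (expMeasure 1))) (fun _ => (1 : ℝ))
      (Function.uncurry g)
    simp only [one_mul, integral_const, probReal_univ, smul_eq_mul] at h2
    refine h1.trans ?_
    rw [← h2]
    rfl
  have hsplit : ∀ z : InputSpace,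
      boolInd (nodeBuffer m (fun s => z (j, s)) t) * g (z (j, t)).2.1 (z (j, t)).2.2
        = boolInd (z (j, t)).1 * g (z (j, t)).2.1 (z (j, t)).2.2
          + boolInd (leftover m (fun s => z (j, s)) t) *
            ((1 - boolInd (z (j, t)).1) * g (z (j, t)).2.1 (z (j, t)).2.2) := by
    intro z
    rw [nodeBuffer_eq, boolInd_or]
    ring
  have hm1 : Measurable fun y : SlotInput => boolInd y.1 * g y.2.1 y.2.2 := hAm.mul hgm
  have hm2 : Measurable fun y : SlotInput => (1 - boolInd y.1) * g y.2.1 y.2.2 :=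
    (measurable_const.sub hAm).mul hgm
  have hL := measurable_boolInd_leftover m j t
  have hR : Measurable[inputSigma {((j, t) : ℕ × ℕ)}] fun z : InputSpace =>
      (1 - boolInd (z (j, t)).1) * g (z (j, t)).2.1 (z (j, t)).2.2 :=
    hm2.comp (measurable_eval_inputSigma (mem_singleton _))
  simp_rw [hsplit]
  rw [integral_add, integral_mul_of_inputSigma prm (disjoint_past_present j t) hL hR,
    integral_eval_inputLaw prm (j, t) hm1, integral_eval_inputLaw prm (j, t) hm2, hfac boolInd,
    hfac (fun b => 1 - boolInd b), integral_coinLaw prm.xi_pos.le prm.xi_le_one,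
    integral_coinLaw prm.xi_pos.le prm.xi_le_one]
  · simp only [boolInd_true, boolInd_false]
    ring
  · refine integrable_of_mem_Icc (hm1.comp (measurable_pi_apply _)) fun z => ?_
    exact ⟨mul_nonneg (boolInd_mem _).1 (hg1 _ _).1,
      mul_le_one₀ (boolInd_mem _).2 (hg1 _ _).1 (hg1 _ _).2⟩
  · refine integrable_of_mem_Icc ((hL.mono (inputSigma_le _) le_rfl).mul
      (hR.mono (inputSigma_le _) le_rfl)) fun z => ?_
    have h1 := boolInd_mem (z (j, t)).1
    have h2 := boolInd_mem (leftover m (fun s => z (j, s)) t)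
    have h3 := hg1 (z (j, t)).2.1 (z (j, t)).2.2
    have h4 : 0 ≤ (1 - boolInd (z (j, t)).1) * g (z (j, t)).2.1 (z (j, t)).2.2 :=
      mul_nonneg (by linarith) h3.1
    exact ⟨mul_nonneg h2.1 h4, mul_le_one₀ h2.2 h4 (mul_le_one₀ (by linarith) h3.1 h3.2)⟩

/-- The buffer occupation probability satisfies the recursion that defines `bufferProb`: an arrival
in the slot or, independently, a packet left over from the previous slot. -/
lemma bufferProb_eq (m : ℝ) (j t : ℕ) :
    prm.xi + (1 - prm.xi) * ∫ z, boolInd (leftover m (fun s => z (j, s)) t) ∂(inputLaw prm)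
      = bufferProb prm m t := by
  induction t with
  | zero => simp [leftover, bufferProb]
  | succ t ih =>
    have hgm : Measurable (Function.uncurry fun (b : Bool) (q : ℝ × ℝ) =>
        1 - boolInd (b && decide (q.1 < m))) :=
      measurable_const.sub (measurable_boolInd.comp
        (measurable_delivers (α := Bool × ℝ × ℝ) (m := fun _ => m)
          (y := fun q => (true, q)) measurable_const (by fun_prop)))
    have h1 := integral_boolInd_nodeBuffer_mul prm m j t hgm fun b q => by
      have := boolInd_mem (b && decide (q.1 < m))
      exact ⟨by linarith, by linarith⟩
    have h2 : ∫ y : SlotInput, (1 - boolInd (y.2.1 && decide (y.2.2.1 < m))) ∂(slotLaw prm)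
        = 1 - prm.p * max 0 (min m 1) := by
      rw [integral_sub (integrable_const _)]
      · have h3 := integral_slotLaw_mul prm (fun _ => 1) boolInd
          (fun u => boolInd (decide (u < m))) fun _ => 1
        simp only [one_mul, mul_one, integral_const, probReal_univ, smul_eq_mul,
          integral_coinLaw prm.p_pos.le prm.p_lt_one.le, boolInd_true, boolInd_false, mul_zero,
          add_zero, integral_boolInd_lt] at h3
        simp_rw [boolInd_and]
        rw [h3]
        simp
      · refine integrable_of_mem_Icc ?_ fun y => boolInd_mem _
        exact measurable_boolInd.comp (measurable_delivers (α := SlotInput) (m := fun _ => m)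
          (y := fun y => y) measurable_const measurable_id)
    rw [ih, h2] at h1
    rw [bufferProb, ← h1]
    congr 2
    refine integral_congr_ae (ae_of_all _ fun z => ?_)
    simp only [leftover, boolInd_and, boolInd_not, delivers]

end AoINetwork

namespace AoINetwork

/-! ### The success probability for a given environment -/

variable (prm : NetworkParams)

/-- Interference power received from a node at `x` with success probability `m` and inputs `y`. -/
noncomputable def interfTerm (t : ℕ) (x : Plane) (m : ℝ) (y : ℕ → SlotInput) : ℝ≥0∞ :=
  if nodeBuffer m y t && (y t).2.1 then
    ENNReal.ofReal (prm.Ptx * (y t).2.2.2 * ‖x‖ ^ (-prm.alpha)) else 0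

/-- The interference as a function of the environment and the inputs. -/
noncomputable def interf (t : ℕ) (x : ℕ → Plane) (m : ℕ → ℝ) (z : InputSpace) : ℝ≥0∞ :=
  ∑' j, interfTerm prm t (x j) (m j) (fun s => z (j + 1, s))

/-- The SINR as a function of the environment and the inputs. -/
noncomputable def envSinr (t : ℕ) (x : ℕ → Plane) (m : ℕ → ℝ) (z : InputSpace) : ℝ≥0∞ :=
  ENNReal.ofReal (prm.Ptx * (z (0, t)).2.2.2 * prm.r ^ (-prm.alpha)) /
    (interf prm t x m z + ENNReal.ofReal prm.sigmaSq)

/-- The success probability of the typical link in slot `t` for a given environment. -/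
noncomputable def envSuccessProb (t : ℕ) (x : ℕ → Plane) (m : ℕ → ℝ) : ℝ :=
  (inputLaw prm).real {z | ENNReal.ofReal prm.theta < envSinr prm t x m z}

/-- The interference power is turned into an exponent by the factor `θ r^α / P_tx`. -/
noncomputable def powerScale : ℝ := prm.theta * prm.r ^ prm.alpha / prm.Ptx

/-- The probability of success without interference. -/
noncomputable def noiseFactor : ℝ := Real.exp (-(prm.theta * prm.r ^ prm.alpha / prm.rho))

/-- `exp (-c i)`, with the value `0` at `i = ∞`. -/
noncomputable def expNegENNReal (c : ℝ) (i : ℝ≥0∞) : ℝ :=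
  if i = ⊤ then 0 else Real.exp (-(c * i.toReal))

lemma powerScale_pos : 0 < powerScale prm := by
  have := prm.theta_pos; have := prm.r_pos; have := prm.Ptx_pos
  unfold powerScale; positivity

lemma powerScale_mul_sigmaSq :
    powerScale prm * prm.sigmaSq = prm.theta * prm.r ^ prm.alpha / prm.rho := by
  have := prm.Ptx_pos.ne'; have := prm.sigmaSq_pos.ne'
  unfold powerScale NetworkParams.rho
  field_simp

lemma expNegENNReal_mem {c : ℝ} (hc : 0 ≤ c) (i : ℝ≥0∞) :
    0 ≤ expNegENNReal c i ∧ expNegENNReal c i ≤ 1 := by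
  unfold expNegENNReal
  split_ifs
  · simp
  · refine ⟨(Real.exp_pos _).le, Real.exp_le_one_iff.2 ?_⟩
    have := mul_nonneg hc (ENNReal.toReal_nonneg (a := i))
    linarith

lemma measurable_expNegENNReal (c : ℝ) : Measurable (expNegENNReal c) := by
  unfold expNegENNReal
  exact Measurable.ite (measurableSet_singleton _) measurable_const
    (Real.measurable_exp.comp (ENNReal.measurable_toReal.const_mul c).neg)

/-- Partial products converge to `exp (-c ∑ f j)` also when the sum is infinite, where the limit is
`0`. -/
lemma tendsto_exp_neg_sum {c : ℝ} (hc : 0 < c) {f : ℕ → ℝ≥0∞} (hf : ∀ j, f j ≠ ⊤) :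
    Tendsto (fun M => ∏ j ∈ Finset.range M, Real.exp (-(c * (f j).toReal))) atTop
      (𝓝 (expNegENNReal c (∑' j, f j))) := by
  have h1 : ∀ M, ∏ j ∈ Finset.range M, Real.exp (-(c * (f j).toReal))
      = Real.exp (-(c * (∑ j ∈ Finset.range M, f j).toReal)) := by
    intro M
    rw [← Real.exp_sum, ENNReal.toReal_sum fun j _ => hf j, Finset.sum_neg_distrib,
      Finset.mul_sum]
  simp_rw [h1]
  have h2 := ENNReal.tendsto_nat_tsum f
  unfold expNegENNReal
  split_ifs with h
  · rw [h] at h2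
    have h3 : Tendsto (fun M => (∑ j ∈ Finset.range M, f j).toReal) atTop atTop := by
      rw [tendsto_atTop]
      intro b
      filter_upwards [h2.eventually (lt_mem_nhds (ENNReal.ofReal_lt_top (r := b)))] with M hM
      exact (ENNReal.ofReal_le_iff_le_toReal (ENNReal.sum_ne_top.2 fun j _ => hf j)).1 hM.le
    exact Real.tendsto_exp_neg_atTop_nhds_zero.comp (h3.const_mul_atTop hc)
  · exact (Real.continuous_exp.tendsto _).comp
      (((ENNReal.tendsto_toReal h).comp h2).const_mul c).neg

lemma measurable_interfTerm {α : Type*} [MeasurableSpace α] {x : α → Plane} {m : α → ℝ}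
    {y : ℕ → α → SlotInput} (t : ℕ) (hx : Measurable x) (hm : Measurable m)
    (hy : ∀ s, Measurable (y s)) :
    Measurable fun a => interfTerm prm t (x a) (m a) (fun s => y s a) := by
  have hb : Measurable fun a => (nodeBuffer (m a) (fun s => y s a) t && (y t a).2.1) :=
    (Measurable.of_discrete (f := fun q : Bool × Bool => q.1 && q.2)).comp
      ((measurable_nodeBuffer t hm fun s _ => hy s).prodMk
        (measurable_fst.comp (measurable_snd.comp (hy t))))
  have hh : Measurable fun a => (y t a).2.2.2 :=
    measurable_snd.comp (measurable_snd.comp (measurable_snd.comp (hy t)))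
  unfold interfTerm
  refine Measurable.ite (hb (measurableSet_singleton true)) ?_ measurable_const
  exact ((hh.const_mul _).mul (hx.norm.pow_const _)).ennreal_ofReal

lemma measurable_interf {α : Type*} [MeasurableSpace α] {x : ℕ → α → Plane} {m : ℕ → α → ℝ}
    {z : α → InputSpace} (t : ℕ) (hx : ∀ j, Measurable (x j)) (hm : ∀ j, Measurable (m j))
    (hz : ∀ j s, Measurable fun a => z a (j + 1, s)) :
    Measurable fun a => interf prm t (fun j => x j a) (fun j => m j a) (z a) :=
  Measurable.tsum fun j => measurable_interfTerm prm (y := fun s a => z a (j + 1, s)) t (hx j)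
    (hm j) (hz j)

lemma measurable_envSinr (t : ℕ) : Measurable fun q : ((ℕ → Plane) × (ℕ → ℝ)) × InputSpace =>
    envSinr prm t q.1.1 q.1.2 q.2 := by
  have h1 : Measurable fun q : ((ℕ → Plane) × (ℕ → ℝ)) × InputSpace =>
      interf prm t q.1.1 q.1.2 q.2 :=
    measurable_interf prm (α := ((ℕ → Plane) × (ℕ → ℝ)) × InputSpace)
      (x := fun j q => q.1.1 j) (m := fun j q => q.1.2 j)
      (z := fun q => q.2) t (by fun_prop) (by fun_prop) (by fun_prop)
  have h2 : Measurable fun q : ((ℕ → Plane) × (ℕ → ℝ)) × InputSpace =>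
      prm.Ptx * (q.2 (0, t)).2.2.2 * prm.r ^ (-prm.alpha) := by fun_prop
  exact h2.ennreal_ofReal.div (h1.add_const _)

lemma measurableSet_envSinr (t : ℕ) :
    MeasurableSet {q : ((ℕ → Plane) × (ℕ → ℝ)) × InputSpace |
      ENNReal.ofReal prm.theta < envSinr prm t q.1.1 q.1.2 q.2} :=
  measurableSet_lt measurable_const (measurable_envSinr prm t)

/-- The factor contributed by one interferer: it is different from `1` only if the interferer
transmits. -/
lemma exp_neg_interfTerm (t : ℕ) (x : Plane) (m : ℝ) (y : ℕ → SlotInput) :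
    Real.exp (-(powerScale prm * (interfTerm prm t x m y).toReal))
      = 1 - boolInd (nodeBuffer m y t) *
        (boolInd (y t).2.1 * (1 - Real.exp (-(relGain prm x * max (y t).2.2.2 0)))) := by
  have hP := prm.Ptx_pos
  have hn : 0 ≤ ‖x‖ ^ (-prm.alpha) := by positivity
  have h1 : powerScale prm * (ENNReal.ofReal (prm.Ptx * (y t).2.2.2 * ‖x‖ ^ (-prm.alpha))).toReal
      = relGain prm x * max (y t).2.2.2 0 := by
    rw [ENNReal.toReal_ofReal', show prm.Ptx * (y t).2.2.2 * ‖x‖ ^ (-prm.alpha)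
      = (prm.Ptx * ‖x‖ ^ (-prm.alpha)) * (y t).2.2.2 by ring]
    have h2 : max (prm.Ptx * ‖x‖ ^ (-prm.alpha) * (y t).2.2.2) 0
        = (prm.Ptx * ‖x‖ ^ (-prm.alpha)) * max (y t).2.2.2 0 := by
      rw [mul_max_of_nonneg _ _ (by positivity), mul_zero]
    rw [h2]
    unfold powerScale relGain
    field_simp
  unfold interfTerm
  cases hb : nodeBuffer m y t <;> cases ha : (y t).2.1
  · simp
  · simp
  · simp
  · simp only [Bool.and_self, if_true, boolInd_true, one_mul]
    rw [h1]; ring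

/-- The mean factor of one interferer; buffer state and fading of the slot are independent, and so
are channel access and buffer state. -/
lemma integral_exp_neg_interfTerm (t j : ℕ) (x : Plane) (m : ℝ) :
    ∫ z, Real.exp (-(powerScale prm * (interfTerm prm t x m (fun s => z (j, s))).toReal))
        ∂(inputLaw prm)
      = 1 - prm.p * bufferProb prm m t * blockProb prm x := by
  have hs := relGain_nonneg prm x
  have hexp : ∀ h : ℝ, 0 ≤ 1 - Real.exp (-(relGain prm x * max h 0)) ∧
      1 - Real.exp (-(relGain prm x * max h 0)) ≤ 1 := by
    intro h
    have h1 := Real.exp_pos (-(relGain prm x * max h 0))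
    have h2 : Real.exp (-(relGain prm x * max h 0)) ≤ 1 := by
      rw [Real.exp_le_one_iff]
      have := mul_nonneg hs (le_max_right h 0)
      linarith
    exact ⟨by linarith, by linarith⟩
  have hg1 : ∀ (b : Bool) (q : ℝ × ℝ),
      0 ≤ boolInd b * (1 - Real.exp (-(relGain prm x * max q.2 0))) ∧
      boolInd b * (1 - Real.exp (-(relGain prm x * max q.2 0))) ≤ 1 := fun b q =>
    ⟨mul_nonneg (boolInd_mem b).1 (hexp q.2).1,
      mul_le_one₀ (boolInd_mem b).2 (hexp q.2).1 (hexp q.2).2⟩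
  have hgm : Measurable (Function.uncurry fun (b : Bool) (q : ℝ × ℝ) =>
      boolInd b * (1 - Real.exp (-(relGain prm x * max q.2 0)))) :=
    (measurable_boolInd.comp measurable_fst).mul (by fun_prop)
  have h1 := integral_boolInd_nodeBuffer_mul prm m j t hgm hg1
  rw [bufferProb_eq] at h1
  have hm : Measurable fun h : ℝ => Real.exp (-(relGain prm x * max h 0)) := by fun_prop
  have h2 : ∫ y : SlotInput, boolInd y.2.1 * (1 - Real.exp (-(relGain prm x * max y.2.2.2 0)))
      ∂(slotLaw prm) = prm.p * blockProb prm x := by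
    have h3 := integral_slotLaw_mul prm (fun _ => 1) boolInd (fun _ => 1)
      fun h => 1 - Real.exp (-(relGain prm x * max h 0))
    rw [integral_sub (integrable_const _) (integrable_of_mem_Icc hm fun h =>
      ⟨(Real.exp_pos _).le, by linarith [(hexp h).1]⟩),
      integral_exp_neg_mul_expMeasure_one hs] at h3
    simp only [one_mul, integral_const, probReal_univ, smul_eq_mul, mul_one,
      integral_coinLaw prm.p_pos.le prm.p_lt_one.le, boolInd_true, boolInd_false, mul_zero,
      add_zero] at h3
    rw [h3, blockProb]
    have : 1 + relGain prm x ≠ 0 := by linarith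
    field_simp
    ring
  simp_rw [exp_neg_interfTerm]
  rw [integral_sub (integrable_const _), h1, h2]
  · simp; ring
  · refine integrable_of_mem_Icc ?_ fun z => ?_
    · refine Measurable.mul ?_ ?_
      · exact measurable_boolInd.comp (measurable_nodeBuffer (α := InputSpace) (m := fun _ => m)
          (y := fun s z => z (j, s)) t measurable_const fun s _ => measurable_pi_apply _)
      · exact hgm.comp (measurable_snd.comp (measurable_pi_apply (j, t)))
    · exact ⟨mul_nonneg (boolInd_mem _).1 (hg1 _ (z (j, t)).2.2).1,
        mul_le_one₀ (boolInd_mem _).2 (hg1 _ (z (j, t)).2.2).1 (hg1 _ (z (j, t)).2.2).2⟩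

lemma measurable_exp_neg_interfTerm (t j : ℕ) (x : Plane) (m : ℝ) {S : Set (ℕ × ℕ)}
    (hS : ∀ s, (j, s) ∈ S) : Measurable[inputSigma S] fun z : InputSpace =>
      Real.exp (-(powerScale prm * (interfTerm prm t x m (fun s => z (j, s))).toReal)) :=
  Real.measurable_exp.comp ((ENNReal.measurable_toReal.comp
    (@measurable_interfTerm prm InputSpace (inputSigma S) (fun _ => x) (fun _ => m)
      (fun s z => z (j, s)) t measurable_const measurable_const
      fun s => measurable_eval_inputSigma (hS s))).const_mul (powerScale prm)).neg

lemma integral_prod_exp_neg_interfTerm (t : ℕ) (x : ℕ → Plane) (m : ℕ → ℝ) (M : ℕ) :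
    ∫ z, ∏ j ∈ Finset.range M, Real.exp (-(powerScale prm *
        (interfTerm prm t (x j) (m j) (fun s => z (j + 1, s))).toReal)) ∂(inputLaw prm)
      = ∏ j ∈ Finset.range M, (1 - prm.p * bufferProb prm (m j) t * blockProb prm (x j)) := by
  induction M with
  | zero => simp
  | succ M ih =>
    simp_rw [Finset.prod_range_succ]
    rw [integral_mul_of_inputSigma prm (S := Iic M ×ˢ univ) (T := {M + 1} ×ˢ univ), ih,
      integral_exp_neg_interfTerm]
    · refine Set.disjoint_prod.2 (Or.inl ?_)
      rw [disjoint_singleton_right]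
      simp
    · refine Finset.measurable_fun_prod _ fun j hj => ?_
      have hj' := Finset.mem_range.1 hj
      exact measurable_exp_neg_interfTerm prm t (j + 1) (x j) (m j)
        fun s => ⟨mem_Iic.2 (by omega), mem_univ _⟩
    · exact measurable_exp_neg_interfTerm prm t (M + 1) (x M) (m M)
        fun s => ⟨mem_singleton _, mem_univ _⟩

lemma tendsto_prod_integral_expNeg_interf (t : ℕ) (x : ℕ → Plane) (m : ℕ → ℝ) :
    Tendsto (fun M => ∏ j ∈ Finset.range M,
        (1 - prm.p * bufferProb prm (m j) t * blockProb prm (x j))) atTop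
      (𝓝 (∫ z, expNegENNReal (powerScale prm) (interf prm t x m z) ∂(inputLaw prm))) := by
  simp_rw [← integral_prod_exp_neg_interfTerm]
  have hc := powerScale_pos prm
  refine tendsto_integral_of_dominated_convergence (fun _ => 1) (fun M => ?_)
    (integrable_const _) (fun M => ae_of_all _ fun z => ?_) (ae_of_all _ fun z => ?_)
  · refine Measurable.aestronglyMeasurable (Finset.measurable_fun_prod _ fun j _ => ?_)
    exact (measurable_exp_neg_interfTerm prm t (j + 1) (x j) (m j) (S := univ)
      fun s => mem_univ _).mono (inputSigma_le _) le_rfl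
  · rw [norm_prod]
    refine Finset.prod_le_one (fun i _ => norm_nonneg _) fun j _ => ?_
    rw [Real.norm_of_nonneg (Real.exp_pos _).le, Real.exp_le_one_iff]
    have := mul_nonneg hc.le (ENNReal.toReal_nonneg
      (a := interfTerm prm t (x j) (m j) (fun s => z (j + 1, s))))
    linarith
  · refine tendsto_exp_neg_sum hc fun j => ?_
    unfold interfTerm
    split_ifs <;> simp

/-- Success means that the gain of the typical link exceeds the scaled interference plus noise. -/
lemma theta_lt_sinr_iff (i : ℝ≥0∞) (h : ℝ) :
    ENNReal.ofReal prm.theta < ENNReal.ofReal (prm.Ptx * h * prm.r ^ (-prm.alpha)) /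
        (i + ENNReal.ofReal prm.sigmaSq)
      ↔ i ≠ ⊤ ∧ powerScale prm * (i.toReal + prm.sigmaSq) < h := by
  have hθ := prm.theta_pos; have hr := prm.r_pos; have hP := prm.Ptx_pos
  have hσ := prm.sigmaSq_pos
  by_cases hi : i = ⊤
  · simp [hi]
  · have hne : i + ENNReal.ofReal prm.sigmaSq ≠ 0 := by
      simp [hσ]
    have hnt : i + ENNReal.ofReal prm.sigmaSq ≠ ⊤ := by finiteness
    rw [ENNReal.lt_div_iff_mul_lt (Or.inl hne) (Or.inl hnt)]
    have h1 : ENNReal.ofReal prm.theta * (i + ENNReal.ofReal prm.sigmaSq)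
        = ENNReal.ofReal (prm.theta * (i.toReal + prm.sigmaSq)) := by
      rw [ENNReal.ofReal_mul hθ.le, ENNReal.ofReal_add ENNReal.toReal_nonneg hσ.le,
        ENNReal.ofReal_toReal hi]
    have h2 : 0 < prm.r ^ prm.alpha := by positivity
    have h3 : 0 ≤ i.toReal := ENNReal.toReal_nonneg
    rw [h1, ENNReal.ofReal_lt_ofReal_iff_of_nonneg (by positivity), Real.rpow_neg hr.le,
      ← div_eq_mul_inv, lt_div_iff₀ h2]
    simp only [ne_eq, hi, not_false_eq_true, true_and]
    unfold powerScale
    rw [div_mul_eq_mul_div, div_lt_iff₀ hP]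
    constructor <;> intro h4 <;> nlinarith

/-- The success probability for given interference power `i`, averaged over the gain of the typical
link. -/
lemma expMeasure_theta_lt_sinr (i : ℝ≥0∞) :
    expMeasure 1 {h | ENNReal.ofReal prm.theta <
        ENNReal.ofReal (prm.Ptx * h * prm.r ^ (-prm.alpha)) / (i + ENNReal.ofReal prm.sigmaSq)}
      = ENNReal.ofReal (noiseFactor prm * expNegENNReal (powerScale prm) i) := by
  have hc := powerScale_pos prm
  simp_rw [theta_lt_sinr_iff]
  unfold expNegENNReal
  by_cases hi : i = ⊤
  · simp [hi]
  · simp only [ne_eq, hi, not_false_eq_true, true_and, if_false]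
    have h1 : 0 ≤ powerScale prm * (i.toReal + prm.sigmaSq) :=
      mul_nonneg hc.le (add_nonneg ENNReal.toReal_nonneg prm.sigmaSq_pos.le)
    refine (expMeasure_one_Ioi h1).trans ?_
    rw [noiseFactor, ← powerScale_mul_sigmaSq, ← Real.exp_add]
    ring_nf

/-- Rayleigh fading turns the success probability into a Laplace transform of the interference. -/
lemma envSuccessProb_eq_integral (t : ℕ) (x : ℕ → Plane) (m : ℕ → ℝ) :
    envSuccessProb prm t x m
      = noiseFactor prm * ∫ z, expNegENNReal (powerScale prm) (interf prm t x m z)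
          ∂(inputLaw prm) := by
  have hc := powerScale_pos prm
  have hHm : Measurable[inputSigma ({0} ×ˢ univ)] fun z : InputSpace => (z (0, t)).2.2.2 :=
    (measurable_snd.comp (measurable_snd.comp measurable_snd)).comp
      (measurable_eval_inputSigma ⟨mem_singleton _, mem_univ _⟩)
  have hIm : Measurable[inputSigma ({0}ᶜ ×ˢ univ)] (interf prm t x m) :=
    @measurable_interf prm InputSpace (inputSigma _) (fun j _ => x j) (fun j _ => m j)
      (fun z => z) t (fun j => measurable_const) (fun j => measurable_const)
      fun j s => measurable_eval_inputSigma ⟨by simp, mem_univ _⟩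
  have hind := indepFun_of_inputSigma prm
    (Set.disjoint_prod.2 (Or.inl disjoint_compl_right)) hHm hIm
  have hHm' : Measurable fun z : InputSpace => (z (0, t)).2.2.2 := hHm.mono (inputSigma_le _) le_rfl
  have hIm' : Measurable (interf prm t x m) := hIm.mono (inputSigma_le _) le_rfl
  rw [indepFun_iff_map_prod_eq_prod_map_map hHm'.aemeasurable hIm'.aemeasurable] at hind
  have hHlaw : (inputLaw prm).map (fun z : InputSpace => (z (0, t)).2.2.2) = expMeasure 1 := by
    have h1 := (measurePreserving_eval_infinitePi (fun _ : ℕ × ℕ => slotLaw prm) (0, t))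
    have h2 : MeasurePreserving (fun y : SlotInput => y.2.2.2) (slotLaw prm) (expMeasure 1) :=
      measurePreserving_snd.comp (measurePreserving_snd.comp measurePreserving_snd)
    exact (h2.comp h1).map_eq
  set A : Set (ℝ × ℝ≥0∞) := {q | ENNReal.ofReal prm.theta <
    ENNReal.ofReal (prm.Ptx * q.1 * prm.r ^ (-prm.alpha)) /
      (q.2 + ENNReal.ofReal prm.sigmaSq)} with hA
  have hAm : MeasurableSet A := by
    refine measurableSet_lt measurable_const ?_
    have h1 : Measurable fun q : ℝ × ℝ≥0∞ => prm.Ptx * q.1 * prm.r ^ (-prm.alpha) := by fun_prop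
    exact h1.ennreal_ofReal.div (measurable_snd.add_const _)
  have h1 : inputLaw prm {z | ENNReal.ofReal prm.theta < envSinr prm t x m z}
      = ((expMeasure 1).prod ((inputLaw prm).map (interf prm t x m))) A := by
    rw [← hHlaw, ← hind, Measure.map_apply (hHm'.prodMk hIm') hAm]
    rfl
  have hm : Measurable fun i => noiseFactor prm * expNegENNReal (powerScale prm) i :=
    (measurable_expNegENNReal _).const_mul _
  have hpos : 0 ≤ noiseFactor prm := (Real.exp_pos _).le
  have := Measure.isProbabilityMeasure_map (μ := inputLaw prm) hIm'.aemeasurable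
  rw [Measure.prod_apply_symm hAm] at h1
  have h2 : ∀ i, expMeasure 1 ((fun h => (h, i)) ⁻¹' A)
      = ENNReal.ofReal (noiseFactor prm * expNegENNReal (powerScale prm) i) :=
    expMeasure_theta_lt_sinr prm
  simp_rw [h2] at h1
  rw [lintegral_map hm.ennreal_ofReal hIm'] at h1
  rw [envSuccessProb, Measure.real, h1, ← integral_const_mul, integral_eq_lintegral_of_nonneg_ae
    (ae_of_all _ fun z => mul_nonneg hpos (expNegENNReal_mem hc.le _).1)
    (hm.comp hIm').aestronglyMeasurable]

lemma tendsto_prod_envSuccessProb (t : ℕ) (x : ℕ → Plane) (m : ℕ → ℝ) :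
    Tendsto (fun M => noiseFactor prm * ∏ j ∈ Finset.range M,
        (1 - prm.p * bufferProb prm (m j) t * blockProb prm (x j))) atTop
      (𝓝 (envSuccessProb prm t x m)) := by
  rw [envSuccessProb_eq_integral]
  exact (tendsto_prod_integral_expNeg_interf prm t x m).const_mul _

/-! ### The limit over time -/

/-- The logarithm of the limiting success probability. -/
noncomputable def logSuccess (x : ℕ → Plane) (m : ℕ → ℝ) : ℝ :=
  -(prm.theta * prm.r ^ prm.alpha / prm.rho)
    + ∑' j, Real.log (1 - activity prm (m j) * blockProb prm (x j))

lemma p_mul_bufferProb_mem (m : ℝ) (t : ℕ) :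
    0 ≤ prm.p * bufferProb prm m t ∧ prm.p * bufferProb prm m t ≤ prm.p := by
  have h := bufferProb_mem prm m t
  have hp := prm.p_pos
  exact ⟨mul_nonneg hp.le h.1, mul_le_of_le_one_right hp.le h.2⟩

lemma one_sub_mul_blockProb_pos {q : ℝ} (hq0 : 0 ≤ q) (hq : q ≤ prm.p) (x : Plane) :
    0 < 1 - q * blockProb prm x := by
  have h1 := blockProb_nonneg prm x
  have h2 := (blockProb_lt_one prm x).le
  have h3 := prm.p_lt_one
  nlinarith [mul_le_mul_of_nonneg_left h2 hq0]

lemma summable_log_one_sub {x : ℕ → Plane} (hx : Summable fun j => blockProb prm (x j))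
    {q : ℕ → ℝ} (hq0 : ∀ j, 0 ≤ q j) (hq : ∀ j, q j ≤ prm.p) :
    Summable fun j => Real.log (1 - q j * blockProb prm (x j)) :=
  Summable.of_norm_bounded (hx.mul_left (prm.p / (1 - prm.p))) fun j =>
    abs_log_one_sub_mul_le prm (hq0 j) (hq j) (blockProb_nonneg prm _) (blockProb_lt_one prm _).le

lemma envSuccessProb_eq_exp {x : ℕ → Plane} (hx : Summable fun j => blockProb prm (x j))
    (m : ℕ → ℝ) (t : ℕ) :
    envSuccessProb prm t x m = noiseFactor prm * Real.exp (∑' j,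
      Real.log (1 - prm.p * bufferProb prm (m j) t * blockProb prm (x j))) := by
  have hq := fun j => p_mul_bufferProb_mem prm (m j) t
  have h1 := (summable_log_one_sub prm hx (fun j => (hq j).1) fun j => (hq j).2).hasSum
  refine tendsto_nhds_unique (tendsto_prod_envSuccessProb prm t x m)
    (((Real.continuous_exp.tendsto _).comp h1.tendsto_sum_nat).const_mul _ |>.congr fun M => ?_)
  simp only [Function.comp]
  rw [Real.exp_sum]
  congr 1
  exact Finset.prod_congr rfl fun j _ =>
    Real.exp_log (one_sub_mul_blockProb_pos prm (hq j).1 (hq j).2 _)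

/-- Convergence over time, by dominated convergence for the series of logarithms; `blockProb` is a
summable bound uniform in time. -/
lemma tendsto_envSuccessProb {x : ℕ → Plane} (hx : Summable fun j => blockProb prm (x j))
    (m : ℕ → ℝ) :
    Tendsto (fun t => envSuccessProb prm t x m) atTop (𝓝 (Real.exp (logSuccess prm x m))) := by
  simp_rw [envSuccessProb_eq_exp prm hx]
  rw [logSuccess, Real.exp_add]
  refine ((Real.continuous_exp.tendsto _).comp ?_).const_mul _
  refine tendsto_tsum_of_dominated_convergence (hx.mul_left (prm.p / (1 - prm.p))) (fun j => ?_)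
    (Eventually.of_forall fun t j => ?_)
  · have h1 := (tendsto_bufferProb prm (m j)).mul_const (blockProb prm (x j))
    exact (Real.continuousAt_log (one_sub_mul_blockProb_pos prm (activity_pos prm _).le
      (activity_le prm _) _).ne').tendsto.comp (h1.const_sub 1)
  · have hq := p_mul_bufferProb_mem prm (m j) t
    exact abs_log_one_sub_mul_le prm hq.1 hq.2 (blockProb_nonneg prm _)
      (blockProb_lt_one prm _).le

end AoINetwork

/-! ### Conditional probabilities given an independent environment -/

/-- Conditioning on `Y` an event that depends on `Y` and an independent `Z` integrates out `Z`. -/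
lemma condExp_indicator_of_indepFun {Ω γ β : Type*} [MeasurableSpace Ω] [MeasurableSpace γ]
    [MeasurableSpace β] {P : Measure Ω} [IsProbabilityMeasure P] {Y : Ω → γ} {Z : Ω → β}
    (hY : Measurable Y) (hZ : Measurable Z) (h : IndepFun Y Z P) {S : Set (γ × β)}
    (hS : MeasurableSet S) :
    P⟦{ω | (Y ω, Z ω) ∈ S} | MeasurableSpace.comap Y inferInstance⟧
      =ᵐ[P] fun ω => (P.map Z).real (Prod.mk (Y ω) ⁻¹' S) := by
  have hprobZ : IsProbabilityMeasure (P.map Z) := Measure.isProbabilityMeasure_map hZ.aemeasurable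
  have hprobY : IsProbabilityMeasure (P.map Y) := Measure.isProbabilityMeasure_map hY.aemeasurable
  have hE : MeasurableSet {ω | (Y ω, Z ω) ∈ S} := (hY.prodMk hZ) hS
  have hk : Measurable fun y => P.map Z (Prod.mk y ⁻¹' S) := measurable_measure_prodMk_left hS
  have hg : Measurable[MeasurableSpace.comap Y inferInstance]
      fun ω => (P.map Z).real (Prod.mk (Y ω) ⁻¹' S) :=
    hk.ennreal_toReal.comp (comap_measurable Y)
  have hg' : Measurable fun ω => (P.map Z).real (Prod.mk (Y ω) ⁻¹' S) :=
    hk.ennreal_toReal.comp hY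
  have hgi : Integrable (fun ω => (P.map Z).real (Prod.mk (Y ω) ⁻¹' S)) P :=
    Integrable.of_bound (C := 1) hg'.aestronglyMeasurable (ae_of_all _ fun ω => by
      rw [Real.norm_of_nonneg measureReal_nonneg]; exact measureReal_le_one)
  refine (ae_eq_condExp_of_forall_setIntegral_eq hY.comap_le
    ((integrable_const (1 : ℝ)).indicator hE) (fun s _ _ => hgi.integrableOn) ?_
    hg.aestronglyMeasurable).symm
  rintro _ ⟨B, hB, rfl⟩ -
  have hYB : MeasurableSet (Y ⁻¹' B) := hY hB
  have h1 : P ({ω | (Y ω, Z ω) ∈ S} ∩ Y ⁻¹' B)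
      = ∫⁻ ω in Y ⁻¹' B, P.map Z (Prod.mk (Y ω) ⁻¹' S) ∂P := by
    have h2 := (indepFun_iff_map_prod_eq_prod_map_map hY.aemeasurable hZ.aemeasurable).1 h
    have h3 : P ({ω | (Y ω, Z ω) ∈ S} ∩ Y ⁻¹' B)
        = (P.map fun ω => (Y ω, Z ω)) (S ∩ Prod.fst ⁻¹' B) := by
      rw [Measure.map_apply (hY.prodMk hZ) (hS.inter (measurable_fst hB))]
      rfl
    rw [h3, h2, Measure.prod_apply (hS.inter (measurable_fst hB)), ← setLIntegral_map hB hk hY,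
      ← lintegral_indicator hB]
    refine lintegral_congr fun y => ?_
    by_cases hy : y ∈ B
    · rw [indicator_of_mem hy]
      congr 1
      ext z; simp [hy]
    · rw [indicator_of_notMem hy]
      convert! measure_empty (μ := P.map Z)
      ext z; simp [hy]
  rw [integral_indicator hE, Measure.restrict_restrict hE, setIntegral_const, smul_eq_mul, mul_one,
    Measure.real, h1, ← integral_toReal (f := fun ω => P.map Z (Prod.mk (Y ω) ⁻¹' S))
      (hk.comp hY).aemeasurable (ae_of_all _ fun ω => measure_lt_top _ _)]
  rfl

namespace AoINetwork

lemma measurable_direction : Measurable direction := by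
  have h : Measurable fun a : ℝ => (![Real.cos a, Real.sin a] : Fin 2 → ℝ) := by
    refine measurable_pi_iff.2 fun i => ?_
    fin_cases i
    · exact Real.measurable_cos
    · exact Real.measurable_sin
  exact (WithLp.measurable_toLp 2 (Fin 2 → ℝ)).comp h

lemma norm_direction (a : ℝ) : ‖direction a‖ = 1 := by
  rw [direction, EuclideanSpace.norm_eq]
  simp

instance isProbabilityMeasure_volume_cond_Ioc :
    IsProbabilityMeasure ((volume : Measure ℝ)[|Ioc (0 : ℝ) (2 * Real.pi)]) := by
  have := Real.pi_pos
  exact cond_isProbabilityMeasure_of_finite (by simpa using this)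
    (by rw [Real.volume_Ioc]; exact ENNReal.ofReal_ne_top)

namespace MeanFieldNetwork

/-! ### The success probability of the typical link -/

variable {prm : NetworkParams} {law : Measure ℝ} {Ω : Type*} [MeasurableSpace Ω] {P : Measure Ω}
  (net : MeanFieldNetwork prm law P)

/-- All slot inputs of the network. -/
def inputs (ω : Ω) : InputSpace := fun jt =>
  (net.arrival jt.1 jt.2 ω, net.access jt.1 jt.2 ω, net.unif jt.1 jt.2 ω, net.fading jt.1 jt.2 ω)

/-- The variables that generate the environment. -/
noncomputable def env (ω : Ω) : (ℕ → Plane) × (ℕ → Plane) × (ℕ → ℝ) :=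
  (fun j => net.tx j ω, fun j => net.rx j ω, fun j => net.rate j ω)

lemma rx_zero (ω : Ω) : net.rx 0 ω = 0 := by
  simp [rx, tx]

lemma norm_tx_zero_sub_rx_zero (ω : Ω) : ‖net.tx 0 ω - net.rx 0 ω‖ = prm.r := by
  rw [rx_zero, sub_zero, tx, norm_neg, norm_smul, norm_direction, mul_one,
    Real.norm_of_nonneg prm.r_pos.le]

lemma sinr_eq (t : ℕ) (ω : Ω) :
    net.sinr t ω = envSinr prm t (fun j => net.interferer j ω) (fun j => net.rate j ω)
      (net.inputs ω) := by
  unfold sinr envSinr interference interf interfTerm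
  rw [norm_tx_zero_sub_rx_zero, rx_zero]
  simp only [sub_zero]
  rfl

lemma measurable_inputs : Measurable net.inputs :=
  measurable_pi_iff.2 fun jt => (net.measurable_arrival jt.1 jt.2).prodMk
    ((net.measurable_access jt.1 jt.2).prodMk
      ((net.measurable_unif jt.1 jt.2).prodMk (net.measurable_fading jt.1 jt.2)))

lemma measurable_tx (j : ℕ) : Measurable (net.tx j) := by
  cases j with
  | zero => exact ((measurable_direction.comp (net.measurable_angle 0)).const_smul prm.r).neg
  | succ j => exact net.poisson.measurable j

lemma measurable_env : Measurable net.env := by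
  refine (measurable_pi_iff.2 net.measurable_tx).prodMk
    ((measurable_pi_iff.2 fun j => ?_).prodMk (measurable_pi_iff.2 net.measurable_rate))
  exact (net.measurable_tx j).add
    ((measurable_direction.comp (net.measurable_angle j)).const_smul prm.r)

lemma measurable_interferer : Measurable fun ω j => net.interferer j ω :=
  measurable_pi_iff.2 net.poisson.measurable

lemma measurable_rates : Measurable fun ω j => net.rate j ω :=
  measurable_pi_iff.2 net.measurable_rate

variable [IsProbabilityMeasure P] [IsProbabilityMeasure law]

lemma map_inputs : P.map net.inputs = inputLaw prm := by
  have := Measure.isProbabilityMeasure_map (μ := P) net.measurable_interferer.aemeasurable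
  have h := net.joint_law
  have hp : MeasurePreserving (fun q : (ℕ → Plane) × (ℕ → ℝ) × (ℕ → ℝ) × InputSpace => q.2.2.2)
      ((P.map fun ω j => net.interferer j ω).prod
        ((Measure.infinitePi fun _ : ℕ => (volume : Measure ℝ)[|Ioc (0 : ℝ) (2 * Real.pi)]).prod
          ((Measure.infinitePi fun _ : ℕ => law).prod (inputLaw prm)))) (inputLaw prm) :=
    measurePreserving_snd.comp (measurePreserving_snd.comp measurePreserving_snd)
  exact (hp.hasLaw.fun_comp h).map_eq

/-- Positions and success probabilities of the interferers are independent, the latter being i.i.d.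
with law `law`. -/
lemma map_interferer_rate :
    P.map (fun ω => ((fun j => net.interferer j ω), fun j => net.rate j ω))
      = (P.map fun ω j => net.interferer j ω).prod (Measure.infinitePi fun _ : ℕ => law) := by
  have := Measure.isProbabilityMeasure_map (μ := P) net.measurable_interferer.aemeasurable
  have h := net.joint_law
  have hp : MeasurePreserving
      (fun q : (ℕ → Plane) × (ℕ → ℝ) × (ℕ → ℝ) × InputSpace => (q.1, q.2.2.1))
      ((P.map fun ω j => net.interferer j ω).prod
        ((Measure.infinitePi fun _ : ℕ => (volume : Measure ℝ)[|Ioc (0 : ℝ) (2 * Real.pi)]).prod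
          ((Measure.infinitePi fun _ : ℕ => law).prod (inputLaw prm))))
      ((P.map fun ω j => net.interferer j ω).prod (Measure.infinitePi fun _ : ℕ => law)) :=
    (MeasurePreserving.id _).prod (measurePreserving_fst.comp measurePreserving_snd)
  exact (hp.hasLaw.fun_comp h).map_eq

/-- The environment is a function of positions, orientations and rates, which are independent of the
slot inputs. -/
lemma indepFun_env_inputs : IndepFun net.env net.inputs P := by
  have := Measure.isProbabilityMeasure_map (μ := P) net.measurable_interferer.aemeasurable
  have h := net.joint_law
  set μX := P.map fun ω j => net.interferer j ω
  set μA := Measure.infinitePi fun _ : ℕ => (volume : Measure ℝ)[|Ioc (0 : ℝ) (2 * Real.pi)]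
  set μR := Measure.infinitePi fun _ : ℕ => law
  set E : Ω → ((ℕ → Plane) × (ℕ → ℝ)) × (ℕ → ℝ) := fun ω =>
    ((fun j => net.interferer j ω, fun j => net.angle j ω), fun j => net.rate j ω) with hE
  have hEm : Measurable E := (net.measurable_interferer.prodMk
    (measurable_pi_iff.2 net.measurable_angle)).prodMk net.measurable_rates
  -- reassociate the product law
  have hassoc := ((measurePreserving_prodAssoc μX μA (μR.prod (inputLaw prm))).symm
    MeasurableEquiv.prodAssoc)
  have hassoc2 := ((measurePreserving_prodAssoc (μX.prod μA) μR (inputLaw prm)).symm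
    MeasurableEquiv.prodAssoc)
  have hjoint : P.map (fun ω => (E ω, net.inputs ω))
      = ((μX.prod μA).prod μR).prod (inputLaw prm) :=
    (hassoc2.hasLaw.fun_comp (hassoc.hasLaw.fun_comp h)).map_eq
  have hEmap : P.map E = (μX.prod μA).prod μR := by
    have h1 := congrArg (Measure.map Prod.fst) hjoint
    rw [Measure.map_map measurable_fst (hEm.prodMk net.measurable_inputs)] at h1
    refine Eq.trans h1 ?_
    exact (measurePreserving_fst (μ := (μX.prod μA).prod μR) (ν := inputLaw prm)).map_eq
  have hind : IndepFun E net.inputs P := by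
    rw [indepFun_iff_map_prod_eq_prod_map_map hEm.aemeasurable net.measurable_inputs.aemeasurable,
      hjoint, hEmap, map_inputs]
  set txE : ((ℕ → Plane) × (ℕ → ℝ)) × (ℕ → ℝ) → ℕ → Plane := fun e j =>
    match j with
    | 0 => -(prm.r • direction (e.1.2 0))
    | j + 1 => e.1.1 j with htxE
  have htxm : ∀ j, Measurable fun e => txE e j := by
    intro j
    cases j with
    | zero => exact ((measurable_direction.comp (by fun_prop :
        Measurable fun e : ((ℕ → Plane) × (ℕ → ℝ)) × (ℕ → ℝ) => e.1.2 0)).const_smul prm.r).neg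
    | succ j => exact (by fun_prop :
        Measurable fun e : ((ℕ → Plane) × (ℕ → ℝ)) × (ℕ → ℝ) => e.1.1 j)
  set G : ((ℕ → Plane) × (ℕ → ℝ)) × (ℕ → ℝ) → (ℕ → Plane) × (ℕ → Plane) × (ℕ → ℝ) := fun e =>
    (txE e, fun j => txE e j + prm.r • direction (e.1.2 j), e.2) with hG
  have hGm : Measurable G := by
    refine (measurable_pi_iff.2 htxm).prodMk ((measurable_pi_iff.2 fun j => ?_).prodMk
      measurable_snd)
    exact (htxm j).add ((measurable_direction.comp (by fun_prop :
        Measurable fun e : ((ℕ → Plane) × (ℕ → ℝ)) × (ℕ → ℝ) => e.1.2 j)).const_smul prm.r)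
  have hGE : net.env = G ∘ E := by
    funext ω
    have htx : ∀ j, net.tx j ω = txE (E ω) j := by
      intro j; cases j <;> rfl
    simp only [env, rx, hG, Function.comp, htx]
    rfl
  rw [hGE]
  exact hind.comp hGm measurable_id

/-- Given the environment, the conditional success probability is obtained by averaging over the
slot inputs. -/
lemma slotSuccessProb_ae_eq (t : ℕ) :
    net.slotSuccessProb t =ᵐ[P] fun ω =>
      envSuccessProb prm t (fun j => net.interferer j ω) (fun j => net.rate j ω) := by
  set S : Set (((ℕ → Plane) × (ℕ → Plane) × (ℕ → ℝ)) × InputSpace) :=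
    {q | ENNReal.ofReal prm.theta < envSinr prm t (fun j => q.1.1 (j + 1)) q.1.2.2 q.2} with hS
  have hSm : MeasurableSet S := by
    have hf : Measurable fun q : ((ℕ → Plane) × (ℕ → Plane) × (ℕ → ℝ)) × InputSpace =>
        (((fun j => q.1.1 (j + 1)), q.1.2.2), q.2) := by fun_prop
    exact hf (measurableSet_envSinr prm t)
  have h := condExp_indicator_of_indepFun net.measurable_env net.measurable_inputs
    net.indepFun_env_inputs hSm
  rw [net.map_inputs] at h
  have hset : {ω | ENNReal.ofReal prm.theta < net.sinr t ω}
      = {ω | (net.env ω, net.inputs ω) ∈ S} := by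
    ext ω
    simp only [mem_ofPred_eq, sinr_eq, hS]
    rfl
  unfold slotSuccessProb
  rw [hset]
  exact h

/-- Almost surely the conditional success probabilities converge. -/
lemma ae_tendsto_slotSuccessProb :
    ∀ᵐ ω ∂P, Tendsto (fun t => net.slotSuccessProb t ω) atTop
      (𝓝 (Real.exp (logSuccess prm (fun j => net.interferer j ω) fun j => net.rate j ω))) := by
  filter_upwards [ae_summable_blockProb prm net.poisson,
    ae_all_iff.2 net.slotSuccessProb_ae_eq] with ω h1 h2
  simp_rw [h2]
  exact tendsto_envSuccessProb prm h1 _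

lemma successProb_ae_eq :
    net.successProb =ᵐ[P] fun ω =>
      Real.exp (logSuccess prm (fun j => net.interferer j ω) fun j => net.rate j ω) :=
  net.ae_tendsto_slotSuccessProb.mono fun _ h => h.limUnder_eq

lemma ae_successProb_mem : ∀ᵐ ω ∂P, net.successProb ω ∈ Icc (0 : ℝ) 1 := by
  filter_upwards [ae_all_iff.2 net.slotSuccessProb_ae_eq, net.ae_tendsto_slotSuccessProb,
    net.successProb_ae_eq] with ω h1 h2 h3
  rw [h3]
  refine isClosed_Icc.mem_of_tendsto h2 (Eventually.of_forall fun t => ?_)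
  rw [h1 t]
  exact ⟨measureReal_nonneg, measureReal_le_one⟩

end MeanFieldNetwork

end AoINetwork

/-! ### The characteristic function of the logarithmic success probability -/

/-- Averaging a finite product of functions of i.i.d. marks. -/
lemma integral_prod_range_infinitePi {law : Measure ℝ} [IsProbabilityMeasure law] {h : ℕ → ℝ → ℂ}
    (hh : ∀ j, Measurable (h j)) (M : ℕ) :
    ∫ m, ∏ j ∈ Finset.range M, h j (m j) ∂(Measure.infinitePi fun _ : ℕ => law)
      = ∏ j ∈ Finset.range M, ∫ y, h j y ∂law := by
  have h1 : iIndepFun (fun (j : ℕ) (m : ℕ → ℝ) => m j) (Measure.infinitePi fun _ : ℕ => law) :=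
    iIndepFun_infinitePi (P := fun _ : ℕ => law) (X := fun _ y => y) fun _ => measurable_id
  have h2 : iIndepFun (fun (j : Fin M) (m : ℕ → ℝ) => m j)
      (Measure.infinitePi fun _ : ℕ => law) := h1.precomp Fin.val_injective
  have h3 := h2.integral_fun_prod_comp (f := fun (j : Fin M) => h j)
    (fun (j : Fin M) => (measurable_pi_apply (j : ℕ)).aemeasurable)
    (fun j => (hh j).aestronglyMeasurable)
  simp only [Finset.prod_range]
  refine h3.trans (Finset.prod_congr rfl fun j _ => ?_)
  have h4 := integral_map (μ := Measure.infinitePi fun _ : ℕ => law) (f := h j)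
    (measurable_pi_apply (j : ℕ)).aemeasurable (hh j).aestronglyMeasurable
  rw [Measure.infinitePi_map_eval (fun _ : ℕ => law) (j : ℕ)] at h4
  exact h4.symm

/-- Averaging over i.i.d. marks, attached independently to a random sequence of points, replaces
each factor of a finite product by its mean over the mark. -/
lemma integral_prod_range_of_iid_marks {E Ω : Type*} [MeasurableSpace E] [MeasurableSpace Ω]
    {P : Measure Ω} [IsProbabilityMeasure P] {law : Measure ℝ} [IsProbabilityMeasure law]
    {X : Ω → ℕ → E} {R : Ω → ℕ → ℝ} (hX : Measurable X) (hR : Measurable R)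
    (hXR : P.map (fun ω => (X ω, R ω)) = (P.map X).prod (Measure.infinitePi fun _ : ℕ => law))
    {H : E × ℝ → ℂ} (hH : Measurable H) (hH1 : ∀ e, ‖H e‖ ≤ 1) (M : ℕ) :
    ∫ ω, ∏ j ∈ Finset.range M, H (X ω j, R ω j) ∂P
      = ∫ ω, ∏ j ∈ Finset.range M, ∫ m, H (X ω j, m) ∂law ∂P := by
  have := Measure.isProbabilityMeasure_map (μ := P) hX.aemeasurable
  have hFm : Measurable fun e : (ℕ → E) × (ℕ → ℝ) => ∏ j ∈ Finset.range M, H (e.1 j, e.2 j) :=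
    Finset.measurable_fun_prod _ fun j _ => hH.comp (by fun_prop)
  have hGm : StronglyMeasurable fun x : ℕ → E => ∏ j ∈ Finset.range M, ∫ m, H (x j, m) ∂law :=
    Finset.stronglyMeasurable_fun_prod _ fun j _ =>
      hH.stronglyMeasurable.integral_prod_right'.comp_measurable (measurable_pi_apply j)
  have hFi : Integrable (fun e : (ℕ → E) × (ℕ → ℝ) => ∏ j ∈ Finset.range M, H (e.1 j, e.2 j))
      ((P.map X).prod (Measure.infinitePi fun _ : ℕ => law)) := by
    refine Integrable.of_bound (C := 1) hFm.aestronglyMeasurable (ae_of_all _ fun e => ?_)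
    rw [norm_prod]
    exact Finset.prod_le_one (fun j _ => norm_nonneg _) fun j _ => hH1 _
  have h1 := integral_prod _ hFi
  rw [← hXR, integral_map (hX.prodMk hR).aemeasurable hFm.aestronglyMeasurable] at h1
  rw [h1, ← integral_map hX.aemeasurable hGm.aestronglyMeasurable]
  refine integral_congr_ae (ae_of_all _ fun x => ?_)
  exact integral_prod_range_infinitePi (h := fun j m => H (x j, m))
    (fun j => hH.comp measurable_prodMk_left) M

namespace AoINetwork.MeanFieldNetwork

variable {prm : NetworkParams} {law : Measure ℝ} {Ω : Type*} [MeasurableSpace Ω] {P : Measure Ω}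
  (net : MeanFieldNetwork prm law P)

/-- The logarithm of the conditional success probability of the typical link. -/
noncomputable def logProb (ω : Ω) : ℝ :=
  logSuccess prm (fun j => net.interferer j ω) fun j => net.rate j ω

lemma measurable_log_one_sub (j : ℕ) : Measurable fun ω =>
    Real.log (1 - activity prm (net.rate j ω) * blockProb prm (net.interferer j ω)) :=
  Real.measurable_log.comp (measurable_const.sub
    (((measurable_activity prm).comp (net.measurable_rate j)).mul
      ((measurable_blockProb prm).comp (net.poisson.measurable j))))

lemma measurable_logProb : Measurable net.logProb :=
  measurable_const.add (Measurable.tsum net.measurable_log_one_sub)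

lemma integrable_tsum_blockProb [IsProbabilityMeasure P] :
    Integrable (fun ω => ∑' j, blockProb prm (net.interferer j ω)) P := by
  have hm : Measurable fun x => ENNReal.ofReal (blockProb prm x) :=
    (measurable_blockProb prm).ennreal_ofReal
  refine ⟨(Measurable.tsum fun j => (measurable_blockProb prm).comp
    (net.poisson.measurable j)).aestronglyMeasurable, ?_⟩
  rw [hasFiniteIntegral_iff_ofReal (ae_of_all _ fun ω =>
    tsum_nonneg fun j => blockProb_nonneg prm _)]
  have h1 : ∀ᵐ ω ∂P, ENNReal.ofReal (∑' j, blockProb prm (net.interferer j ω))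
      = ∑' j, ENNReal.ofReal (blockProb prm (net.interferer j ω)) :=
    (ae_summable_blockProb prm net.poisson).mono fun ω hω =>
      ENNReal.ofReal_tsum_of_nonneg (fun j => blockProb_nonneg prm _) hω
  rw [lintegral_congr_ae h1, net.poisson.lintegral_tsum_comp hm]
  exact ENNReal.mul_lt_top ENNReal.ofReal_lt_top
    ((hasFiniteIntegral_iff_ofReal (ae_of_all _ (blockProb_nonneg prm))).1
      (integrable_blockProb prm).2)

/-- The logarithm of the success probability has a first moment. -/
lemma integrable_logProb [IsProbabilityMeasure P] : Integrable net.logProb P := by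
  refine (integrable_const _).add (Integrable.mono'
    (net.integrable_tsum_blockProb.const_mul (prm.p / (1 - prm.p)))
    (Measurable.tsum net.measurable_log_one_sub).aestronglyMeasurable ?_)
  refine (ae_summable_blockProb prm net.poisson).mono fun ω hω => ?_
  rw [← tsum_mul_left]
  exact tsum_of_norm_bounded (hω.mul_left _).hasSum fun j =>
    abs_log_one_sub_activity_mul_le prm _ (blockProb_nonneg prm _) (blockProb_lt_one prm _).le

variable [IsProbabilityMeasure P] [IsProbabilityMeasure law]

/-- `integral_prod_range_of_iid_marks` for the positions and rates of the interferers. -/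
lemma integral_prod_exp_I_mul_log (w : ℝ) (M : ℕ) :
    ∫ ω, ∏ j ∈ Finset.range M, Complex.exp (Complex.I * (w * Real.log (1 -
        activity prm (net.rate j ω) * blockProb prm (net.interferer j ω)) : ℝ)) ∂P
      = ∫ ω, ∏ j ∈ Finset.range M,
          (1 - markDefect prm law w (blockProb prm (net.interferer j ω))) ∂P := by
  have hpair : Measurable fun q : Plane × ℝ => (blockProb prm q.1, q.2) :=
    ((measurable_blockProb prm).comp measurable_fst).prodMk measurable_snd
  have hH := (measurable_exp_I_mul_log prm w).comp hpair
  have hmark : ∀ d, ∫ m, Complex.exp (Complex.I * (w * Real.log (1 - activity prm m * d) : ℝ)) ∂law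
      = 1 - markDefect prm law w d := by
    intro d
    have h1 := integral_sub (integrable_const (μ := law) (1 : ℂ))
      (integrable_exp_I_mul_log prm law w d)
    simp only [integral_const, probReal_univ, one_smul] at h1
    unfold markDefect
    rw [h1, sub_sub_cancel]
  have h1 := integral_prod_range_of_iid_marks net.measurable_interferer net.measurable_rates
    net.map_interferer_rate hH (fun _ => (norm_exp_I_mul_ofReal _).le) M
  simp only [Function.comp_def, hmark] at h1
  exact h1

/-- The characteristic function of the logarithmic success probability, from the generating
functional of the interferers. -/
theorem charFun_map_logProb (w : ℝ) :
    charFun (P.map net.logProb) w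
      = Complex.exp (-(Complex.I * w * ((prm.theta * prm.r ^ prm.alpha / prm.rho : ℝ) : ℂ))
          - ((prm.lam * Real.pi * prm.r ^ 2 * prm.theta ^ prm.delta : ℝ) : ℂ)
            * radialExponent prm law w) := by
  set c : ℝ := prm.theta * prm.r ^ prm.alpha / prm.rho with hc
  set a : ℕ → Ω → ℝ := fun j ω => w * Real.log (1 -
    activity prm (net.rate j ω) * blockProb prm (net.interferer j ω)) with ha
  have ham : ∀ j, Measurable (a j) := fun j => (net.measurable_log_one_sub j).const_mul w
  have hg : Measurable fun x => 1 - markDefect prm law w (blockProb prm x) :=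
    measurable_const.sub ((measurable_markDefect prm law w).comp (measurable_blockProb prm))
  have hg1 : ∀ x, ‖1 - markDefect prm law w (blockProb prm x)‖ ≤ 1 := by
    intro x
    have h1 := integral_sub (integrable_const (μ := law) (1 : ℂ))
      (integrable_exp_I_mul_log prm law w (blockProb prm x))
    simp only [integral_const, probReal_univ, one_smul] at h1
    unfold markDefect
    rw [h1, sub_sub_cancel]
    refine (norm_integral_le_of_norm_le_const (ae_of_all _ fun m =>
      (norm_exp_I_mul_ofReal _).le)).trans ?_
    simp
  have hgi : Integrable (fun x => 1 - (1 - markDefect prm law w (blockProb prm x))) := by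
    simpa using integrable_markDefect_blockProb prm law w
  have hpgfl := net.poisson.tendsto_integral_prod prm.lam_pos.le hg hg1 hgi
  simp only [sub_sub_cancel] at hpgfl
  rw [integral_comp_blockProb prm (markDefect prm law w)] at hpgfl
  simp_rw [← net.integral_prod_exp_I_mul_log w] at hpgfl
  have hlim : Tendsto (fun M => ∫ ω, ∏ j ∈ Finset.range M,
      Complex.exp (Complex.I * (a j ω : ℝ)) ∂P) atTop
      (𝓝 (∫ ω, Complex.exp (Complex.I * ((∑' j, a j ω : ℝ) : ℂ)) ∂P)) := by
    refine tendsto_integral_of_dominated_convergence (fun _ => 1) (fun M => ?_)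
      (integrable_const _) (fun M => ae_of_all _ fun ω => ?_) ?_
    · refine Measurable.aestronglyMeasurable (Finset.measurable_fun_prod _ fun j _ => ?_)
      exact Complex.measurable_exp.comp ((Complex.measurable_ofReal.comp (ham j)).const_mul _)
    · rw [norm_prod]
      exact Finset.prod_le_one (fun j _ => norm_nonneg _) fun j _ => (norm_exp_I_mul_ofReal _).le
    · refine (ae_summable_blockProb prm net.poisson).mono fun ω hω => ?_
      have hs : Summable fun j => a j ω := (summable_log_one_sub prm hω
        (fun j => (activity_pos prm (net.rate j ω)).le)
        fun j => activity_le prm (net.rate j ω)).mul_left w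
      have h1 := (Complex.continuous_exp.tendsto _).comp
        (((Complex.continuous_ofReal.tendsto _).comp hs.hasSum.tendsto_sum_nat).const_mul Complex.I)
      refine h1.congr fun M => ?_
      simp only [Function.comp]
      rw [← Complex.exp_sum, Complex.ofReal_sum, Finset.mul_sum]
  have hval := tendsto_nhds_unique hlim hpgfl
  rw [charFun_apply_real, integral_map net.measurable_logProb.aemeasurable (by fun_prop)]
  have hsplit : ∀ ω, Complex.exp (w * net.logProb ω * Complex.I)
      = Complex.exp (-(Complex.I * w * c)) * Complex.exp (Complex.I * ((∑' j, a j ω : ℝ) : ℂ)) := by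
    intro ω
    rw [← Complex.exp_add]
    congr 1
    simp only [ha]
    rw [tsum_mul_left, logProb, logSuccess, ← hc]
    push_cast
    ring
  simp_rw [hsplit]
  rw [integral_const_mul, hval, ← Complex.exp_add]
  congr 1
  unfold radialExponent areaScale
  rw [Complex.real_smul]
  push_cast
  ring

lemma integrableOn_charFun_map_logProb : IntegrableOn (charFun (P.map net.logProb)) (Ioi 0) := by
  have := Measure.isProbabilityMeasure_map (μ := P) net.measurable_logProb.aemeasurable
  have h1 := prm.lam_pos; have h2 := prm.r_pos; have h3 := prm.theta_pos; have h4 := Real.pi_pos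
  refine integrableOn_of_norm_le_exp_radialExponent prm law measurable_charFun
    (C := prm.lam * Real.pi * prm.r ^ 2 * prm.theta ^ prm.delta) (by positivity) fun w => ?_
  rw [charFun_map_logProb, Complex.norm_exp]
  refine le_of_eq (congrArg Real.exp ?_)
  rw [Complex.sub_re, Complex.re_ofReal_mul]
  simp

/-! ### The fixed-point equation -/

variable {net}

lemma ae_law_mem_Icc (hnet : net.IsSelfConsistent) : ∀ᵐ m ∂law, m ∈ Icc (0 : ℝ) 1 := by
  have h := net.ae_successProb_mem
  rw [← hnet.map_eq]
  exact (ae_map_iff hnet.aemeasurable measurableSet_Icc).2 h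

/-- The law is carried by `[0, 1]`, so neither the restriction to this interval nor the clamping in
`activity` matters. -/
lemma seriesTerm_cdf (hnet : net.IsSelfConsistent) (w : ℝ) (k : ℕ) :
    seriesTerm prm (cdf law) w k = Ring.choose (Complex.I * (w : ℂ)) k *
      ((∫ v in Ioi (0 : ℝ), pathLossIntegrand prm k v : ℝ) : ℂ) *
      ((∫ m, activity prm m ^ k ∂law : ℝ) : ℂ) := by
  unfold seriesTerm
  have h1 : ∫ m, activity prm m ^ k ∂law = ∫ m in Icc (0 : ℝ) 1, activity prm m ^ k ∂law := by
    rw [Measure.restrict_eq_self_of_ae_mem (ae_law_mem_Icc hnet)]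
  rw [measure_cdf law, h1]
  congr 2
  refine setIntegral_congr_fun measurableSet_Icc fun m hm => ?_
  simp only [activity]
  rw [min_eq_left hm.2, max_eq_right hm.1, div_pow]

lemma hasSum_seriesTerm_cdf (hnet : net.IsSelfConsistent) (w : ℝ) :
    HasSum (fun k : ℕ => seriesTerm prm (cdf law) w (k + 1)) (radialExponent prm law w) := by
  simp_rw [seriesTerm_cdf hnet]
  exact hasSum_radialExponent prm law w

lemma inversionIntegrand_cdf (hnet : net.IsSelfConsistent) {u : ℝ} (hu : 0 < u) (w : ℝ) :
    inversionIntegrand prm (cdf law) u w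
      = (Complex.exp (-(w * Real.log u * Complex.I)) * charFun (P.map net.logProb) w).im
          / (Real.pi * w) := by
  unfold inversionIntegrand
  rw [(hasSum_seriesTerm_cdf hnet w).tsum_eq, ← charFun_map_logProb net w,
    Complex.cpow_def_of_ne_zero (by exact_mod_cast hu.ne'), ← Complex.ofReal_log hu.le]
  ring_nf

lemma cdf_law_eq (hnet : net.IsSelfConsistent) {u : ℝ} (hu : 0 < u) :
    cdf law u = (P.map net.logProb).real (Iic (Real.log u)) := by
  have h1 : law = P.map (fun ω => Real.exp (net.logProb ω)) :=
    hnet.map_eq.symm.trans (Measure.map_congr net.successProb_ae_eq)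
  rw [cdf_eq_real]
  conv_lhs => rw [h1]
  have hm : Measurable fun ω => Real.exp (net.logProb ω) :=
    Real.measurable_exp.comp net.measurable_logProb
  refine (map_measureReal_apply hm measurableSet_Iic).trans ?_
  rw [map_measureReal_apply net.measurable_logProb measurableSet_Iic]
  congr 1
  ext ω
  simp [Real.le_log_iff_exp_le hu]

end AoINetwork.MeanFieldNetwork

theorem theorem1 {Ω : Type*} [MeasurableSpace Ω] (P : Measure Ω) [IsProbabilityMeasure P]
    (prm : AoINetwork.NetworkParams) (law : Measure ℝ) [IsProbabilityMeasure law]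
    (net : AoINetwork.MeanFieldNetwork prm law P) (hnet : net.IsSelfConsistent) :
    -- the conditional transmission success probability exists as a limit over time
    (∀ᵐ ω ∂P, Tendsto (fun t => net.slotSuccessProb t ω) atTop (𝓝 (net.successProb ω))) ∧
    -- the integrals over `v` and the binomial series converge
    (∀ k : ℕ, 1 ≤ k → IntegrableOn (AoINetwork.pathLossIntegrand prm k) (Ioi 0)) ∧
    (∀ w : ℝ, Summable (fun k : ℕ =>
      AoINetwork.seriesTerm prm (cdf (P.map net.successProb)) w (k + 1))) ∧
    -- the CDF satisfies the fixed-point equation, whose integral converges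
    (∀ u : ℝ, 0 < u →
      IntegrableOn (AoINetwork.inversionIntegrand prm (cdf (P.map net.successProb)) u) (Ioi 0) ∧
      cdf (P.map net.successProb) u = 1 / 2 -
        ∫ w in Ioi (0 : ℝ),
          AoINetwork.inversionIntegrand prm (cdf (P.map net.successProb)) u w) := by
  have hmap : P.map net.successProb = law := hnet.map_eq
  rw [hmap]
  have := Measure.isProbabilityMeasure_map (μ := P) net.measurable_logProb.aemeasurable
  have hY : Integrable (fun y : ℝ => y) (P.map net.logProb) :=
    (integrable_map_measure (by fun_prop) net.measurable_logProb.aemeasurable).2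
      net.integrable_logProb
  refine ⟨?_, fun k hk => ?_, fun w => ?_, fun u hu => ?_⟩
  · filter_upwards [net.ae_tendsto_slotSuccessProb, net.successProb_ae_eq] with ω h1 h2
    rw [h2]
    exact h1
  · obtain ⟨k, rfl⟩ := Nat.exists_eq_add_of_le' hk
    exact AoINetwork.integrableOn_pathLossIntegrand_succ prm k
  · exact (AoINetwork.MeanFieldNetwork.hasSum_seriesTerm_cdf hnet w).summable
  · have h := integrableOn_and_measureReal_Iic_eq_of_charFun hY
      net.integrableOn_charFun_map_logProb (Real.log u)
    rw [AoINetwork.MeanFieldNetwork.cdf_law_eq hnet hu]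
    rw [funext (AoINetwork.MeanFieldNetwork.inversionIntegrand_cdf hnet hu)]
    exact h
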